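/- **The model.** An MMV-RAM has a parameter $s\ge 2$ and a main memory whose words are $B$-bit integers in two's complement. A program is a finite program, with sequencing and while-loops, whose instructions are: scalar instructions (constants, $+$, truncated $-$, $\times$, integer division, comparison of scalar registers, which hold lengths and addresses only and receive no data from memory); vector instructions, each of which reads one or two ranges of consecutive words of lengths $\ell_1,\ell_2$ and writes a range of consecutive words; and matrix multiplications of an $r\times s$ by an $s\times s$ integer matrix, both stored in row-major order. A vector instruction is a family of Boolean circuits ($\wedge,\vee$ of unbounded fan-in, $\neg$), indexed by $(\ell_1,\ell_2,B,s)$, of constant depth and of size polynomial in these parameters, that is uniform (its description is definable by bounded formulas of arithmetic, i.e. first-order/DLOGTIME-uniform). Every scalar instruction, loop test, vector instruction and matrix multiplication is one step. Its work is, respectively, $1$, $1$, the number of edges of the circuit used, and $\mathcal M(r)$, where $\mathcal M:\mathbb N\to[0,\infty)$ is additive. **Theorem.** There are an MMV-RAM program $\mathrm{MULT}$ and a constant $C\in\mathbb N$ such that the following holds for all integers $s\ge2$, $n\ge1$, $M\ge1$, all word widths $B\ge C(1+\log_2 n+\log_2 M)$, all additive $\mathcal M$, and all $x,y\in\mathbb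 Z^n$ with $|x(i)|,|y(i)|\le M$ for all $i$. Started with $n,B,s$ in three scalar registers and with $x,y$ in memory (everything else being zero), $\mathrm{MULT}$ halts with the element-wise product $z(i)=x(i)y(i)$ in memory, after * at most $C\,(1+\log_s B)$ steps, and * with work at most $C\left(\mathcal M(\lceil nB/s\rceil)+nsB^2\right)$, and there is no overflow: all entries of all computed matrix products, and the products $z(i)$, are $B$-bit integers, and all values computed in scalar registers are at most $(nsB)^C$. In particular $B=O(1+\log n+\log M)$ bits suffice, and for $B\ge s$ the number of steps is $O(\log_s B)$ and the work is $O(\mathcal M(nB/s)+nsB^2)$. -/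

import Mathlib

open scoped NNReal

namespace MMVRAM

/-! ## Uniformity -/

/-- Predicates on `ℕ^k` that are definable by a bounded (`Δ₀`) formula of arithmetic: equations
between polynomials with natural coefficients, closed under negation, conjunction and
quantification over `z ≤ p(v)` for a polynomial `p`. Over numbers polynomial in the input length
this is first-order uniformity with `+` and `×` (equivalently `DLOGTIME`-uniformity), which implies
logarithmic-space uniformity. -/
inductive BoundedArith : {k : ℕ} → ((Fin k → ℕ) → Prop) → Prop
  | eq {k : ℕ} (p q : MvPolynomial (Fin k) ℕ) :
      BoundedArith (fun v => MvPolynomial.eval v p = MvPolynomial.eval v q)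
  | not {k : ℕ} {P : (Fin k → ℕ) → Prop} :
      BoundedArith P → BoundedArith (fun v => ¬ P v)
  | and {k : ℕ} {P Q : (Fin k → ℕ) → Prop} :
      BoundedArith P → BoundedArith Q → BoundedArith (fun v => P v ∧ Q v)
  | exists_le {k : ℕ} {P : (Fin (k + 1) → ℕ) → Prop} (p : MvPolynomial (Fin k) ℕ) :
      BoundedArith P →
      BoundedArith (fun v => ∃ z : ℕ, z ≤ MvPolynomial.eval v p ∧ P (Fin.snoc v z))

/-! ## Vector instructions: uniform `AC⁰` circuit families -/

/-- The gates of a Boolean circuit. Conjunctions and disjunctions have unbounded fan-in; with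
fan-in zero they are the constants `true` and `false`. -/
inductive GateKind
  | and
  | or
  | not

/-- What a member of a circuit family may depend on: the lengths of the two operand vectors
(`len₂ = 0` for a unary instruction), the number `width` of bits of a word, and the model
parameter `side`, the side length `s` of the right factor of the matrix unit. -/
structure Shape where
  len₁ : ℕ
  len₂ : ℕ
  width : ℕ
  side : ℕ

/-- The number of input bits. -/
def Shape.numIn (sh : Shape) : ℕ := (sh.len₁ + sh.len₂) * sh.width

/-- A family of Boolean circuits, one for each shape. Nodes are natural numbers: the nodes below
`numIn` are the input bits, the nodes `numIn, …, numIn + numGates - 1` are the gates, and the first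
`outLen * width` gates are the output bits. Bit `j` of word `i` of the concatenation of the two
operands is the node `i * width + j`; bit `j` of word `i` of the result is the node
`numIn + i * width + j`. `Wire sh u v` says that there is an edge from node `u` to node `v`. -/
structure CircuitFamily where
  outLen : Shape → ℕ
  numGates : Shape → ℕ
  kind : Shape → ℕ → GateKind
  Wire : Shape → ℕ → ℕ → Prop

namespace CircuitFamily

/-- The number of nodes of the circuit of shape `sh`. -/
def numNodes (F : CircuitFamily) (sh : Shape) : ℕ := sh.numIn + F.numGates sh

/-- The size of the circuit of shape `sh`: its number of edges. -/
noncomputable def size (F : CircuitFamily) (sh : Shape) : ℕ :=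
  Set.ncard {e : ℕ × ℕ | F.Wire sh e.1 e.2}

/-- Edges join nodes and enter gates only, negations have exactly one predecessor, and the output
bits are gates. -/
def WellFormed (F : CircuitFamily) : Prop :=
  ∀ sh : Shape,
    (∀ u v, F.Wire sh u v → u < F.numNodes sh ∧ sh.numIn ≤ v ∧ v < F.numNodes sh) ∧
    (∀ v, sh.numIn ≤ v → v < F.numNodes sh → F.kind sh v = GateKind.not → ∃! u, F.Wire sh u v) ∧
    F.outLen sh * sh.width ≤ F.numGates sh

/-- The circuits are acyclic, and one constant bounds the lengths of all their paths. -/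
def ConstantDepth (F : CircuitFamily) : Prop :=
  ∃ d : ℕ, ∀ sh : Shape, ∃ level : ℕ → ℕ,
    (∀ u, level u ≤ d) ∧ ∀ u v, F.Wire sh u v → level u < level v

/-- The number of gates, and hence also the number of edges, is polynomial. -/
def PolynomialSize (F : CircuitFamily) : Prop :=
  ∃ c : ℕ, ∀ sh : Shape, F.numGates sh ≤ (sh.len₁ + sh.len₂ + sh.width + sh.side + 2) ^ c

/-- Output length, number of gates, types of gates and edges are definable in bounded
arithmetic. -/
def Uniform (F : CircuitFamily) : Prop :=
  BoundedArith (fun v : Fin 5 → ℕ => F.outLen ⟨v 0, v 1, v 2, v 3⟩ = v 4) ∧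
  BoundedArith (fun v : Fin 5 → ℕ => F.numGates ⟨v 0, v 1, v 2, v 3⟩ = v 4) ∧
  BoundedArith (fun v : Fin 5 → ℕ => F.kind ⟨v 0, v 1, v 2, v 3⟩ (v 4) = GateKind.and) ∧
  BoundedArith (fun v : Fin 5 → ℕ => F.kind ⟨v 0, v 1, v 2, v 3⟩ (v 4) = GateKind.or) ∧
  BoundedArith (fun v : Fin 6 → ℕ => F.Wire ⟨v 0, v 1, v 2, v 3⟩ (v 4) (v 5))

/-- `val` is the assignment of truth values to the nodes of the circuit of shape `sh` on the input
bits `inp`. (By acyclicity it is unique on the nodes.) -/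
def Evaluates (F : CircuitFamily) (sh : Shape) (inp val : ℕ → Bool) : Prop :=
  (∀ u, u < sh.numIn → val u = inp u) ∧
  ∀ v, sh.numIn ≤ v → v < F.numNodes sh →
    (val v = true ↔
      match F.kind sh v with
      | GateKind.and => ∀ u, F.Wire sh u v → val u = true
      | GateKind.or => ∃ u, F.Wire sh u v ∧ val u = true
      | GateKind.not => ∃ u, F.Wire sh u v ∧ val u = false)

end CircuitFamily

/-- A vector instruction: a uniform family of `AC⁰` circuits. -/
structure VecInstr extends CircuitFamily where
  wellFormed : toCircuitFamily.WellFormed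
  constantDepth : toCircuitFamily.ConstantDepth
  polynomialSize : toCircuitFamily.PolynomialSize
  uniform : toCircuitFamily.Uniform

/-! ## The machine -/

/-- The operations of the scalar unit (truncated subtraction, rounded-down division). -/
inductive ScalarOp
  | add
  | sub
  | mul
  | div

/-- The function computed by a scalar operation. -/
def ScalarOp.apply : ScalarOp → ℕ → ℕ → ℕ
  | .add, a, b => a + b
  | .sub, a, b => a - b
  | .mul, a, b => a * b
  | .div, a, b => a / b

/-- Programs. All natural number arguments except the constant `k` are names of scalar registers;
lengths and addresses are taken from these registers.
* `const d k`: put `k` into register `d`;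
* `scalar op d a b`: apply `op` to registers `a`, `b` and put the result into register `d`;
* `vec I a₁ l₁ a₂ l₂ d`: apply the vector instruction `I` to the `l₁` words from address `a₁` and
  the `l₂` words from address `a₂`, write the result from address `d` on;
* `matmul a r b d`: multiply the `r × s` matrix at address `a` by the `s × s` matrix at address `b`,
  write the product from address `d` on;
* `whileLt a b P`: repeat `P` as long as register `a` is less than register `b`. -/
inductive Prog
  | const (d k : ℕ)
  | scalar (op : ScalarOp) (d a b : ℕ)
  | vec (I : VecInstr) (a₁ l₁ a₂ l₂ d : ℕ)
  | matmul (a r b d : ℕ)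
  | seq (P Q : Prog)
  | whileLt (a b : ℕ) (P : Prog)

/-- The parameters of a machine: the side `s` of the right factor of the matrix unit, the number
`width` of bits of a memory word, the largest number `maxScalar` that a scalar register can hold,
and the work `mmWork r` of multiplying an `r × s` by an `s × s` matrix, which is additive in `r`. -/
structure Machine where
  s : ℕ
  width : ℕ
  maxScalar : ℕ
  mmWork : ℕ →+ ℝ≥0

/-- A state: the scalar registers, and the main memory, whose words are read as integers in two's
complement. There is no instruction that moves data from the memory to the scalar registers. -/
@[ext] structure State (B : ℕ) where
  reg : ℕ → ℕ
  mem : ℕ → BitVec B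

namespace State

variable {B : ℕ}

/-- Assign a value to a scalar register. -/
def setReg (σ : State B) (d k : ℕ) : State B :=
  { σ with reg := Function.update σ.reg d k }

/-- Write the `len` words `w 0, w 1, …` to consecutive addresses from `dst` on. -/
def write (σ : State B) (dst len : ℕ) (w : ℕ → BitVec B) : State B :=
  { σ with mem := fun a => if dst ≤ a ∧ a < dst + len then w (a - dst) else σ.mem a }

/-- Bit `u` of the concatenation of the `l₁` words from address `a₁` and the words from `a₂`. -/
def operandBit (σ : State B) (a₁ l₁ a₂ : ℕ) (u : ℕ) : Bool :=
  (if u / B < l₁ then σ.mem (a₁ + u / B) else σ.mem (a₂ + (u / B - l₁))).getLsbD (u % B)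

/-- Entry `(i, j)` of the product of the matrices with `s` columns that are stored in row-major
order from the addresses `a` and `b` on. -/
def matEntry (σ : State B) (s a b i j : ℕ) : ℤ :=
  ∑ k ∈ Finset.range s, (σ.mem (a + (i * s + k))).toInt * (σ.mem (b + (k * s + j))).toInt

end State

/-- `z` is representable as a `B`-bit integer in two's complement. -/
def Fits (B : ℕ) (z : ℤ) : Prop := -(2 ^ (B - 1) : ℤ) ≤ z ∧ z < 2 ^ (B - 1)

/-- The shape of the circuit that is used for operands of lengths `l₁` and `l₂`. -/
def Machine.shape (m : Machine) (l₁ l₂ : ℕ) : Shape := ⟨l₁, l₂, m.width, m.s⟩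

/-- `Exec m P σ τ t w`: on the machine `m`, the program `P` started in `σ` halts in `τ` after `t`
steps with total work `w`, and no scalar operation and no matrix multiplication overflows.
Each scalar instruction (also each test of a loop), each vector instruction and each matrix
multiplication is one step. A scalar instruction has work `1`, a vector instruction the size of its
circuit, a matrix multiplication with `r` rows the work `mmWork r`. -/
inductive Exec (m : Machine) :
    Prog → State m.width → State m.width → ℕ → ℝ≥0 → Prop
  | const (d k : ℕ) (σ : State m.width) (hk : k ≤ m.maxScalar) :
      Exec m (.const d k) σ (σ.setReg d k) 1 1
  | scalar (op : ScalarOp) (d a b : ℕ) (σ : State m.width)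
      (h : op.apply (σ.reg a) (σ.reg b) ≤ m.maxScalar) :
      Exec m (.scalar op d a b) σ (σ.setReg d (op.apply (σ.reg a) (σ.reg b))) 1 1
  | vec (I : VecInstr) (a₁ l₁ a₂ l₂ d : ℕ) (σ : State m.width) (val : ℕ → Bool)
      (hval : I.Evaluates (m.shape (σ.reg l₁) (σ.reg l₂))
        (σ.operandBit (σ.reg a₁) (σ.reg l₁) (σ.reg a₂)) val) :
      Exec m (.vec I a₁ l₁ a₂ l₂ d) σ
        (σ.write (σ.reg d) (I.outLen (m.shape (σ.reg l₁) (σ.reg l₂)))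
          (fun i => BitVec.ofFnLE fun j : Fin m.width =>
            val ((m.shape (σ.reg l₁) (σ.reg l₂)).numIn + i * m.width + j)))
        1 (I.size (m.shape (σ.reg l₁) (σ.reg l₂)))
  | matmul (a r b d : ℕ) (σ : State m.width)
      (h : ∀ i < σ.reg r, ∀ j < m.s, Fits m.width (σ.matEntry m.s (σ.reg a) (σ.reg b) i j)) :
      Exec m (.matmul a r b d) σ
        (σ.write (σ.reg d) (σ.reg r * m.s)
          (fun i => BitVec.ofInt m.width (σ.matEntry m.s (σ.reg a) (σ.reg b) (i / m.s) (i % m.s))))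
        1 (m.mmWork (σ.reg r))
  | seq {P Q : Prog} {σ τ ρ : State m.width} {t t' : ℕ} {w w' : ℝ≥0} :
      Exec m P σ τ t w → Exec m Q τ ρ t' w' → Exec m (.seq P Q) σ ρ (t + t') (w + w')
  | while_false {a b : ℕ} {P : Prog} {σ : State m.width} :
      ¬ σ.reg a < σ.reg b → Exec m (.whileLt a b P) σ σ 1 1
  | while_true {a b : ℕ} {P : Prog} {σ τ ρ : State m.width} {t t' : ℕ} {w w' : ℝ≥0} :
      σ.reg a < σ.reg b → Exec m P σ τ t w → Exec m (.whileLt a b P) τ ρ t' w' →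
      Exec m (.whileLt a b P) σ ρ (1 + t + t') (1 + w + w')

/-- The initial state for two input vectors of length `n`: registers `0`, `1`, `2` contain `n`, the
word width and `s`; the vectors occupy the addresses `0, …, n - 1` and `n, …, 2 n - 1`; everything
else is zero. -/
def initState (m : Machine) {n : ℕ} (x y : Fin n → ℤ) : State m.width where
  reg := fun r => if r = 0 then n else if r = 1 then m.width else if r = 2 then m.s else 0
  mem := fun a =>
    if h : a < n then BitVec.ofInt m.width (x ⟨a, h⟩)
    else if h' : a - n < n then BitVec.ofInt m.width (y ⟨a - n, h'⟩)
    else 0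

/-- The vector `z` is stored at the addresses `2 n, …, 3 n - 1`. -/
def IsOutput {B n : ℕ} (τ : State B) (z : Fin n → ℤ) : Prop :=
  ∀ i : Fin n, (τ.mem (2 * n + i)).toInt = z i

end MMVRAM

/-! Multiplication by shift-and-add, with the additions done by the matrix unit. Let h = ⌊B/4⌋. The
constant in the bound on B is so large that all inputs lie strictly between -2^h and 2^h. If y_j are
the two's complement bits of Y, then Y = ∑_{j<h} y_j 2^j - y_h 2^h, where y_h is the sign bit. Since
the bitwise complement of X is -X - 1, the product X·Y is the sum of the h + 2 words y_j·(X ≪ j) for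
j < h, y_h·(~X ≪ h) and y_h·2^h (`sum_partialValue`). Every bit of these words is constant or a
conjunction of two bits of X, Y and ~X. So circuits of depth one with at most two wires per gate
produce them, and the size of such a circuit is linear in its number of output bits
(`Layer.size_le`).

For the summation let P = s^e be the largest power of s with P ≤ B. Zero words pad the partial
products of each component to P groups of c = ⌈B/P⌉ ≤ s words, and g = ⌊s/c⌋ groups are stored in
each row of a matrix with s columns. Multiplication by the 0/1 matrix with ones at (k, ⌊k/c⌋) adds
up all groups at once (`sum_block`, `exec_round`). This leaves exactly P words per component, and e
further rounds with groups of s words reduce them to one (`exec_sum`). A round takes constantly many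
steps, and e ≤ log_s B.

There is no overflow, because every intermediate value is a sum over a block of partial products of
one component, and the absolute values of all of these add up to at most 2^(2h+1) < 2^(B-1)
(`sum_abs_partialValue`).

For the work, the first round has R rows with R·s ≤ 4nB + 2s, as rows and groups are filled at least
to a constant fraction up to one extra row (`mul_rows_le`). The later rounds have n·s^i rows for i <
e, a geometric sum (`geomSum_mul_le`). Additivity of the cost of the matrix unit turns both into
multiples of the cost of ⌈nB/s⌉ rows. The vector instructions cost O(B) per word written; the
dominating one writes the R·s partial products. The 0/1 matrices consist of constant gates and cost
nothing. -/

namespace MMVRAM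

/-! ## Closure properties of bounded arithmetic -/

namespace BoundedArith

theorem congr {k : ℕ} {P Q : (Fin k → ℕ) → Prop} (hP : BoundedArith P) (h : ∀ v, P v ↔ Q v) :
    BoundedArith Q := by
  have : P = Q := funext fun v => propext (h v)
  exact this ▸ hP

theorem eval_bind₁_nat {k m : ℕ} (q : Fin k → MvPolynomial (Fin m) ℕ) (p : MvPolynomial (Fin k) ℕ)
    (v : Fin m → ℕ) :
    MvPolynomial.eval v (MvPolynomial.bind₁ q p) =
      MvPolynomial.eval (fun i => MvPolynomial.eval v (q i)) p :=
  MvPolynomial.eval₂Hom_bind₁ _ _ _ _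

/-- Bounded arithmetic is closed under the substitution of polynomials for the variables. -/
theorem subst {k : ℕ} {P : (Fin k → ℕ) → Prop} (hP : BoundedArith P) :
    ∀ {m : ℕ} (q : Fin k → MvPolynomial (Fin m) ℕ),
      BoundedArith fun v : Fin m → ℕ => P fun i => MvPolynomial.eval v (q i) := by
  induction hP with
  | eq p r =>
    intro m q
    refine (BoundedArith.eq (MvPolynomial.bind₁ q p) (MvPolynomial.bind₁ q r)).congr fun v => ?_
    rw [eval_bind₁_nat, eval_bind₁_nat]
  | not _ ih => exact fun q => (ih q).not
  | and _ _ ih₁ ih₂ => exact fun q => (ih₁ q).and (ih₂ q)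
  | @exists_le k P p _ ih =>
    intro m q
    -- Under the quantifier, the bound variable is substituted by itself and the other polynomials
    -- are moved to the larger context.
    let q' : Fin (k + 1) → MvPolynomial (Fin (m + 1)) ℕ :=
      Fin.snoc (α := fun _ => MvPolynomial (Fin (m + 1)) ℕ)
        (fun i => MvPolynomial.rename Fin.castSucc (q i)) (MvPolynomial.X (Fin.last m))
    refine (BoundedArith.exists_le (MvPolynomial.bind₁ q p) (ih q')).congr fun v => ?_
    have key : ∀ z : ℕ, (fun i => MvPolynomial.eval (Fin.snoc (α := fun _ => ℕ) v z) (q' i)) =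
        Fin.snoc (α := fun _ => ℕ) (fun i => MvPolynomial.eval v (q i)) z := by
      intro z
      funext i
      refine Fin.lastCases ?_ (fun j => ?_) i
      · simp [q']
      · have : (Fin.snoc (α := fun _ => ℕ) v z) ∘ Fin.castSucc = v := by
          funext l; simp
        simp [q', MvPolynomial.eval_rename, this]
    simp only [eval_bind₁_nat, key]

theorem or {k : ℕ} {P Q : (Fin k → ℕ) → Prop} (hP : BoundedArith P) (hQ : BoundedArith Q) :
    BoundedArith fun v => P v ∨ Q v :=
  ((hP.not.and hQ.not).not).congr fun v => by tauto

theorem imp {k : ℕ} {P Q : (Fin k → ℕ) → Prop} (hP : BoundedArith P) (hQ : BoundedArith Q) :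
    BoundedArith fun v => P v → Q v :=
  (hP.not.or hQ).congr fun v => by tauto

theorem false' {k : ℕ} : BoundedArith fun _ : Fin k → ℕ => False :=
  (BoundedArith.eq 0 1).congr fun v => by simp

theorem true' {k : ℕ} : BoundedArith fun _ : Fin k → ℕ => True :=
  (BoundedArith.eq 0 0).congr fun v => by simp

end BoundedArith

/-- Functions that are bounded by a polynomial and whose graph is definable in bounded
arithmetic. -/
def BoundedFun {k : ℕ} (f : (Fin k → ℕ) → ℕ) : Prop :=
  (∃ p : MvPolynomial (Fin k) ℕ, ∀ v, f v ≤ MvPolynomial.eval v p) ∧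
    BoundedArith fun v : Fin (k + 1) → ℕ => f (fun i => v i.castSucc) = v (Fin.last k)

namespace BoundedFun

open MvPolynomial in
theorem of_poly {k : ℕ} (p : MvPolynomial (Fin k) ℕ) :
    BoundedFun fun v => MvPolynomial.eval v p := by
  refine ⟨⟨p, fun v => le_rfl⟩, ?_⟩
  refine (BoundedArith.eq (rename Fin.castSucc p) (X (Fin.last k))).congr fun v => ?_
  simp only [eval_rename, eval_X]
  rfl

theorem var {k : ℕ} (i : Fin k) : BoundedFun fun v : Fin k → ℕ => v i := by
  simpa using of_poly (MvPolynomial.X i : MvPolynomial (Fin k) ℕ)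

theorem const {k : ℕ} (c : ℕ) : BoundedFun fun _ : Fin k → ℕ => c := by
  simpa using of_poly (MvPolynomial.C c : MvPolynomial (Fin k) ℕ)

/-- The graph of a bounded function in a larger context. -/
theorem graph {k m : ℕ} {f : (Fin k → ℕ) → ℕ} (hf : BoundedFun f) (ι : Fin k → Fin m)
    (j : Fin m) : BoundedArith fun v : Fin m → ℕ => f (fun i => v (ι i)) = v j := by
  refine (hf.2.subst (m := m) (Fin.snoc (α := fun _ => MvPolynomial (Fin m) ℕ)
    (fun i => MvPolynomial.X (ι i)) (MvPolynomial.X j))).congr fun v => ?_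
  simp

/-- A bounded function of two variables, applied to bounded functions. -/
theorem comp₂ {k : ℕ} {f g : (Fin k → ℕ) → ℕ} (hf : BoundedFun f) (hg : BoundedFun g)
    {op : ℕ → ℕ → ℕ} (hop : BoundedArith fun v : Fin 3 → ℕ => op (v 0) (v 1) = v 2)
    (hb : ∃ p : MvPolynomial (Fin k) ℕ, ∀ v, op (f v) (g v) ≤ MvPolynomial.eval v p) :
    BoundedFun fun v => op (f v) (g v) := by
  refine ⟨hb, ?_⟩
  obtain ⟨pf, hpf⟩ := hf.1
  obtain ⟨pg, hpg⟩ := hg.1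
  -- The values of `f` and `g` become two quantified variables. Their polynomial bounds make these
  -- quantifiers bounded, which is why a bound is part of `BoundedFun`.
  have h1 := hf.graph (m := k + 3) (fun i => i.castSucc.castSucc.castSucc)
    (Fin.last k).succ.castSucc
  have h2 := hg.graph (m := k + 3) (fun i => i.castSucc.castSucc.castSucc) (Fin.last (k + 2))
  have h3 := hop.subst (m := k + 3) ![MvPolynomial.X (Fin.last k).succ.castSucc,
    MvPolynomial.X (Fin.last (k + 2)), MvPolynomial.X (Fin.last k).castSucc.castSucc]
  have h4 := BoundedArith.exists_le
    (MvPolynomial.rename (fun i => (Fin.castSucc i).castSucc) pg) ((h1.and h2).and h3)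
  have h5 := BoundedArith.exists_le (MvPolynomial.rename Fin.castSucc pf) h4
  refine h5.congr fun v => ?_
  have e0 : (Fin.last k).succ.castSucc = (Fin.last (k + 1)).castSucc := rfl
  simp only [e0, Fin.snoc_castSucc, Fin.snoc_last, MvPolynomial.eval_rename, Function.comp_def,
    Matrix.cons_val, MvPolynomial.eval_X]
  constructor
  · rintro ⟨a, -, b, -, ⟨rfl, rfl⟩, h⟩
    exact h
  · intro h
    exact ⟨_, hpf _, _, hpg _, ⟨rfl, rfl⟩, h⟩

/-- A binary relation, applied to bounded functions. -/
theorem rel₂ {k : ℕ} {f g : (Fin k → ℕ) → ℕ} (hf : BoundedFun f) (hg : BoundedFun g)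
    {R : ℕ → ℕ → Prop} (hR : BoundedArith fun v : Fin 2 → ℕ => R (v 0) (v 1)) :
    BoundedArith fun v => R (f v) (g v) := by
  obtain ⟨pf, hpf⟩ := hf.1
  obtain ⟨pg, hpg⟩ := hg.1
  have h1 := hf.graph (m := k + 2) (fun i => i.castSucc.castSucc) (Fin.last k).castSucc
  have h2 := hg.graph (m := k + 2) (fun i => i.castSucc.castSucc) (Fin.last (k + 1))
  have h3 := hR.subst (m := k + 2) ![MvPolynomial.X (Fin.last k).castSucc,
    MvPolynomial.X (Fin.last (k + 1))]
  have h4 := BoundedArith.exists_le (MvPolynomial.rename Fin.castSucc pg) ((h1.and h2).and h3)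
  refine (BoundedArith.exists_le pf h4).congr fun v => ?_
  simp only [Fin.snoc_castSucc, Fin.snoc_last, MvPolynomial.eval_rename, Function.comp_def,
    Matrix.cons_val_zero, Matrix.cons_val_one, MvPolynomial.eval_X]
  constructor
  · rintro ⟨a, -, b, -, ⟨rfl, rfl⟩, h⟩
    exact h
  · intro h
    exact ⟨_, hpf _, _, hpg _, ⟨rfl, rfl⟩, h⟩

/-! ### Comparison and arithmetic of definable functions -/

section

variable {k : ℕ} {f g : (Fin k → ℕ) → ℕ}

theorem eq (hf : BoundedFun f) (hg : BoundedFun g) : BoundedArith fun v => f v = g v :=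
  rel₂ hf hg (R := fun a b => a = b)
    ((BoundedArith.eq (MvPolynomial.X 0) (MvPolynomial.X 1)).congr fun v => by simp)

theorem le (hf : BoundedFun f) (hg : BoundedFun g) : BoundedArith fun v => f v ≤ g v := by
  refine rel₂ hf hg (R := fun a b => a ≤ b)
    ((BoundedArith.exists_le (MvPolynomial.X 1) (BoundedArith.eq (k := 3)
      (MvPolynomial.X 0 + MvPolynomial.X 2) (MvPolynomial.X 1))).congr fun v => ?_)
  have e0 : ∀ z : ℕ, (Fin.snoc (α := fun _ => ℕ) v z : Fin 3 → ℕ) 0 = v 0 := fun z => rfl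
  have e1 : ∀ z : ℕ, (Fin.snoc (α := fun _ => ℕ) v z : Fin 3 → ℕ) 1 = v 1 := fun z => rfl
  have e2 : ∀ z : ℕ, (Fin.snoc (α := fun _ => ℕ) v z : Fin 3 → ℕ) 2 = z := fun z => rfl
  simp only [map_add, MvPolynomial.eval_X, e0, e1, e2]
  constructor
  · rintro ⟨z, -, h⟩; omega
  · intro h; exact ⟨v 1 - v 0, by omega, by omega⟩

theorem lt (hf : BoundedFun f) (hg : BoundedFun g) : BoundedArith fun v => f v < g v :=
  (hg.le hf).not.congr fun _ => not_le

theorem add (hf : BoundedFun f) (hg : BoundedFun g) : BoundedFun fun v => f v + g v := by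
  obtain ⟨pf, hpf⟩ := hf.1
  obtain ⟨pg, hpg⟩ := hg.1
  refine comp₂ hf hg (op := fun a b => a + b) ?_ ⟨pf + pg, fun v => ?_⟩
  · exact (BoundedArith.eq (MvPolynomial.X 0 + MvPolynomial.X 1) (MvPolynomial.X 2)).congr
      fun v => by simp
  · simpa using add_le_add (hpf v) (hpg v)

theorem mul (hf : BoundedFun f) (hg : BoundedFun g) : BoundedFun fun v => f v * g v := by
  obtain ⟨pf, hpf⟩ := hf.1
  obtain ⟨pg, hpg⟩ := hg.1
  refine comp₂ hf hg (op := fun a b => a * b) ?_ ⟨pf * pg, fun v => ?_⟩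
  · exact (BoundedArith.eq (MvPolynomial.X 0 * MvPolynomial.X 1) (MvPolynomial.X 2)).congr
      fun v => by simp
  · simpa using Nat.mul_le_mul (hpf v) (hpg v)

theorem sub (hf : BoundedFun f) (hg : BoundedFun g) : BoundedFun fun v => f v - g v := by
  obtain ⟨pf, hpf⟩ := hf.1
  refine comp₂ hf hg (op := fun a b => a - b) ?_ ⟨pf, fun v => (Nat.sub_le _ _).trans (hpf v)⟩
  refine ((((var 0).lt (var 1)).imp ((var 2).eq (const 0))).and
    (((var 1).le (var 0)).imp (((var 2).add (var 1)).eq (var 0)))).congr fun v => ?_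
  omega

theorem div (hf : BoundedFun f) (hg : BoundedFun g) : BoundedFun fun v => f v / g v := by
  obtain ⟨pf, hpf⟩ := hf.1
  refine comp₂ hf hg (op := fun a b => a / b) ?_
    ⟨pf, fun v => (Nat.div_le_self _ _).trans (hpf v)⟩
  refine ((((var 1).eq (const 0)).imp ((var 2).eq (const 0))).and
    -- For a positive divisor b, the quotient q is characterized by q·b ≤ a < (q + 1)·b; the clause
    -- before covers the convention a / 0 = 0.
    (((const 0).lt (var 1)).imp (((((var 2).mul (var 1)).le (var 0))).and
      ((var 0).lt (((var 2).add (const 1)).mul (var 1)))))).congr fun v => ?_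
  rcases Nat.eq_zero_or_pos (v 1) with h | h
  · simp [h, eq_comm]
  · have : v 1 ≠ 0 := by omega
    simp only [h, this, false_imp_iff, true_and, forall_const]
    rw [Nat.div_eq_iff h]
    rw [Nat.add_mul]
    omega

theorem mod (hf : BoundedFun f) (hg : BoundedFun g) : BoundedFun fun v => f v % g v := by
  have h := hf.sub (hg.mul (hf.div hg))
  have e : (fun v => f v % g v) = fun v => f v - g v * (f v / g v) := by
    funext v
    have := Nat.mod_add_div (f v) (g v)
    omega
  rw [e]
  exact h

theorem ite {P : (Fin k → ℕ) → Prop} (hP : BoundedArith P) [∀ v, Decidable (P v)]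
    (hf : BoundedFun f) (hg : BoundedFun g) :
    BoundedFun fun v => if P v then f v else g v := by
  obtain ⟨pf, hpf⟩ := hf.1
  obtain ⟨pg, hpg⟩ := hg.1
  refine ⟨⟨pf + pg, fun v => ?_⟩, ?_⟩
  · have h1 := hpf v
    have h2 := hpg v
    simp only [map_add]
    split_ifs <;> omega
  · have h1 := hP.subst (m := k + 1) fun i => MvPolynomial.X i.castSucc
    simp only [MvPolynomial.eval_X] at h1
    refine ((h1.imp hf.2).and (h1.not.imp hg.2)).congr fun v => ?_
    beta_reduce
    split_ifs with h <;> simp [h]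

end

end BoundedFun

/-! ## Circuits of depth one -/

/-- A description of a family of circuits of depth one in which every gate is an output bit: bit
`j` of word `w` of the result is a gate of type `kind sh w j` whose predecessors, if it is active,
are the bits `bit₁ sh w j` and `bit₂ sh w j` of the words `word₁ sh w j` and `word₂ sh w j` of the
operands, as far as these exist. -/
structure Layer where
  outLen : Shape → ℕ
  kind : Shape → ℕ → ℕ → GateKind
  active : Shape → ℕ → ℕ → Prop
  word₁ : Shape → ℕ → ℕ → ℕ
  bit₁ : Shape → ℕ → ℕ → ℕ
  word₂ : Shape → ℕ → ℕ → ℕ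
  bit₂ : Shape → ℕ → ℕ → ℕ

namespace Layer

/-- Bit `(a, b)` of the operands is a predecessor of bit `j` of word `w` of the result. -/
def Source (L : Layer) (sh : Shape) (w j a b : ℕ) : Prop :=
  L.active sh w j ∧ ((a = L.word₁ sh w j ∧ b = L.bit₁ sh w j) ∨
    (a = L.word₂ sh w j ∧ b = L.bit₂ sh w j)) ∧ a < sh.len₁ + sh.len₂ ∧ b < sh.width

/-- The circuits described by a layer. -/
def toFamily (L : Layer) : CircuitFamily where
  outLen := L.outLen
  numGates := fun sh => L.outLen sh * sh.width
  kind := fun sh v => L.kind sh ((v - sh.numIn) / sh.width) ((v - sh.numIn) % sh.width)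
  Wire := fun sh u v => (sh.numIn ≤ v ∧ v < sh.numIn + L.outLen sh * sh.width) ∧
    L.Source sh ((v - sh.numIn) / sh.width) ((v - sh.numIn) % sh.width)
      (u / sh.width) (u % sh.width)

/-- All components of a layer are definable in bounded arithmetic. -/
structure Definable (L : Layer) : Prop where
  outLen : ∀ {k : ℕ} {a b c d : (Fin k → ℕ) → ℕ}, BoundedFun a → BoundedFun b → BoundedFun c →
    BoundedFun d → BoundedFun fun v => L.outLen ⟨a v, b v, c v, d v⟩
  kind_and : ∀ {k : ℕ} {a b c d w j : (Fin k → ℕ) → ℕ}, BoundedFun a → BoundedFun b →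
    BoundedFun c → BoundedFun d → BoundedFun w → BoundedFun j →
    BoundedArith fun v => L.kind ⟨a v, b v, c v, d v⟩ (w v) (j v) = GateKind.and
  kind_or : ∀ {k : ℕ} {a b c d w j : (Fin k → ℕ) → ℕ}, BoundedFun a → BoundedFun b →
    BoundedFun c → BoundedFun d → BoundedFun w → BoundedFun j →
    BoundedArith fun v => L.kind ⟨a v, b v, c v, d v⟩ (w v) (j v) = GateKind.or
  active : ∀ {k : ℕ} {a b c d w j : (Fin k → ℕ) → ℕ}, BoundedFun a → BoundedFun b →
    BoundedFun c → BoundedFun d → BoundedFun w → BoundedFun j →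
    BoundedArith fun v => L.active ⟨a v, b v, c v, d v⟩ (w v) (j v)
  word₁ : ∀ {k : ℕ} {a b c d w j : (Fin k → ℕ) → ℕ}, BoundedFun a → BoundedFun b →
    BoundedFun c → BoundedFun d → BoundedFun w → BoundedFun j →
    BoundedFun fun v => L.word₁ ⟨a v, b v, c v, d v⟩ (w v) (j v)
  bit₁ : ∀ {k : ℕ} {a b c d w j : (Fin k → ℕ) → ℕ}, BoundedFun a → BoundedFun b →
    BoundedFun c → BoundedFun d → BoundedFun w → BoundedFun j →
    BoundedFun fun v => L.bit₁ ⟨a v, b v, c v, d v⟩ (w v) (j v)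
  word₂ : ∀ {k : ℕ} {a b c d w j : (Fin k → ℕ) → ℕ}, BoundedFun a → BoundedFun b →
    BoundedFun c → BoundedFun d → BoundedFun w → BoundedFun j →
    BoundedFun fun v => L.word₂ ⟨a v, b v, c v, d v⟩ (w v) (j v)
  bit₂ : ∀ {k : ℕ} {a b c d w j : (Fin k → ℕ) → ℕ}, BoundedFun a → BoundedFun b →
    BoundedFun c → BoundedFun d → BoundedFun w → BoundedFun j →
    BoundedFun fun v => L.bit₂ ⟨a v, b v, c v, d v⟩ (w v) (j v)

/-- Negations have exactly one predecessor. -/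
def NotUnique (L : Layer) : Prop :=
  ∀ sh w j, w < L.outLen sh → j < sh.width → L.kind sh w j = GateKind.not →
    ∃ a b, ∀ a' b', L.Source sh w j a' b' ↔ a' = a ∧ b' = b

theorem div_lt_of_lt_numIn {sh : Shape} {u : ℕ} (h : u / sh.width < sh.len₁ + sh.len₂)
    (hb : u % sh.width < sh.width) : u < sh.numIn := by
  have h0 : 0 < sh.width := by omega
  exact (Nat.div_lt_iff_lt_mul h0).1 h

variable {L : Layer}

theorem wellFormed (hL : L.NotUnique) : L.toFamily.WellFormed := by
  intro sh
  refine ⟨fun u v h => ?_, fun v h1 h2 hk => ?_, le_rfl⟩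
  · have h3 := div_lt_of_lt_numIn h.2.2.2.1 h.2.2.2.2
    have h4 := h.1
    simp only [CircuitFamily.numNodes, toFamily]
    omega
  · simp only [CircuitFamily.numNodes, toFamily] at h2 hk
    have hB : 0 < sh.width := by
      rcases Nat.eq_zero_or_pos sh.width with h | h
      · simp [h] at h2; omega
      · exact h
    obtain ⟨a, b, hab⟩ := hL sh _ _ ((Nat.div_lt_iff_lt_mul hB).2 (by omega))
      (Nat.mod_lt _ hB) hk
    have hb := ((hab a b).2 ⟨rfl, rfl⟩).2.2.2
    refine ⟨a * sh.width + b, ⟨⟨h1, h2⟩, ?_⟩, ?_⟩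
    · refine (hab _ _).2 ⟨?_, ?_⟩
      · rw [Nat.add_comm, Nat.add_mul_div_right _ _ hB, Nat.div_eq_of_lt hb, Nat.zero_add]
      · rw [Nat.add_comm, Nat.add_mul_mod_self_right, Nat.mod_eq_of_lt hb]
    · rintro u ⟨-, hu⟩
      obtain ⟨e1, e2⟩ := (hab _ _).1 hu
      rw [← e1, ← e2, Nat.div_add_mod']

/-- All wires start at input bits, so level 0 for inputs and level 1 for gates suffices. -/
theorem constantDepth : L.toFamily.ConstantDepth := by
  refine ⟨1, fun sh => ⟨fun u => if u < sh.numIn then 0 else 1, fun u => ?_, fun u v h => ?_⟩⟩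
  · dsimp only; split_ifs <;> omega
  · have h3 := div_lt_of_lt_numIn h.2.2.2.1 h.2.2.2.2
    have h4 : ¬ v < sh.numIn := not_lt.2 h.1.1
    simp [h3, h4]

/-- `Definable` allows arbitrary bounded functions as arguments. Hence the word and bit numbers
decoded from a node by division with remainder can be inserted directly. -/
theorem uniform (hL : L.Definable) : L.toFamily.Uniform := by
  have hn : ∀ k : ℕ, BoundedFun fun v : Fin (k + 4) → ℕ => (v 0 + v 1) * v 2 := fun k =>
    ((BoundedFun.var 0).add (.var 1)).mul (.var 2)
  have hw : ∀ k (i : Fin (k + 4)),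
      BoundedFun fun v : Fin (k + 4) → ℕ => (v i - (v 0 + v 1) * v 2) / v 2 := fun k i =>
    ((BoundedFun.var i).sub (hn k)).div (.var 2)
  have hj : ∀ k (i : Fin (k + 4)),
      BoundedFun fun v : Fin (k + 4) → ℕ => (v i - (v 0 + v 1) * v 2) % v 2 := fun k i =>
    ((BoundedFun.var i).sub (hn k)).mod (.var 2)
  have ho : ∀ k : ℕ, BoundedFun fun v : Fin (k + 4) → ℕ => L.outLen ⟨v 0, v 1, v 2, v 3⟩ :=
    fun k => hL.outLen (.var 0) (.var 1) (.var 2) (.var 3)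
  refine ⟨(ho 1).eq (.var 4), ((ho 1).mul (.var 2)).eq (.var 4),
    hL.kind_and (.var 0) (.var 1) (.var 2) (.var 3) (hw 1 4) (hj 1 4),
    hL.kind_or (.var 0) (.var 1) (.var 2) (.var 3) (hw 1 4) (hj 1 4), ?_⟩
  have hu : BoundedFun fun v : Fin 6 → ℕ => v 4 / v 2 := (BoundedFun.var 4).div (.var 2)
  have hu' : BoundedFun fun v : Fin 6 → ℕ => v 4 % v 2 := (BoundedFun.var 4).mod (.var 2)
  refine (((hn 2).le (.var 5)).and ((BoundedFun.var 5).lt ((hn 2).add ((ho 2).mul (.var 2))))).and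
    ((hL.active (.var 0) (.var 1) (.var 2) (.var 3) (hw 2 5) (hj 2 5)).and
      ((((hu.eq (hL.word₁ (.var 0) (.var 1) (.var 2) (.var 3) (hw 2 5) (hj 2 5))).and
        (hu'.eq (hL.bit₁ (.var 0) (.var 1) (.var 2) (.var 3) (hw 2 5) (hj 2 5)))).or
        ((hu.eq (hL.word₂ (.var 0) (.var 1) (.var 2) (.var 3) (hw 2 5) (hj 2 5))).and
        (hu'.eq (hL.bit₂ (.var 0) (.var 1) (.var 2) (.var 3) (hw 2 5) (hj 2 5))))).and
        ((hu.lt ((BoundedFun.var 0).add (.var 1))).and (hu'.lt (.var 2)))))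

theorem polynomialSize {c : ℕ}
    (hL : ∀ sh : Shape, L.outLen sh ≤ (sh.len₁ + sh.len₂ + sh.width + sh.side + 2) ^ c) :
    L.toFamily.PolynomialSize := by
  refine ⟨c + 1, fun sh => ?_⟩
  rw [pow_succ]
  exact Nat.mul_le_mul (hL sh) (by omega)

/-- The vector instruction described by a layer. -/
def toInstr (L : Layer) (h₁ : L.NotUnique) (h₂ : L.Definable)
    (h₃ : ∃ c, ∀ sh : Shape, L.outLen sh ≤ (sh.len₁ + sh.len₂ + sh.width + sh.side + 2) ^ c) :
    VecInstr where
  toCircuitFamily := L.toFamily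
  wellFormed := wellFormed h₁
  constantDepth := constantDepth
  polynomialSize := polynomialSize h₃.choose_spec
  uniform := uniform h₂

/-- A gate has at most two predecessors, so all edges lie in the images of two functions on the set
of gates. -/
theorem size_le (L : Layer) (sh : Shape) : L.toFamily.size sh ≤ 2 * (L.outLen sh * sh.width) := by
  classical
  set N := L.outLen sh * sh.width with hN
  let W : ℕ → ℕ := fun v => (v - sh.numIn) / sh.width
  let J : ℕ → ℕ := fun v => (v - sh.numIn) % sh.width
  let f₁ : ℕ → ℕ × ℕ := fun v =>
    (L.word₁ sh (W v) (J v) * sh.width + L.bit₁ sh (W v) (J v), v)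
  let f₂ : ℕ → ℕ × ℕ := fun v =>
    (L.word₂ sh (W v) (J v) * sh.width + L.bit₂ sh (W v) (J v), v)
  let I : Finset ℕ := Finset.Ico sh.numIn (sh.numIn + N)
  have hsub : {e : ℕ × ℕ | L.toFamily.Wire sh e.1 e.2} ⊆
      ((I.image f₁ ∪ I.image f₂ : Finset (ℕ × ℕ)) : Set (ℕ × ℕ)) := by
    rintro ⟨u, v⟩ ⟨hv, -, h, -⟩
    have hu := Nat.div_add_mod' u sh.width
    have hvI : v ∈ I := Finset.mem_Ico.2 hv
    simp only [Finset.coe_union, Finset.coe_image, Set.mem_union, Set.mem_image, Finset.mem_coe]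
    rcases h with ⟨h1, h2⟩ | ⟨h1, h2⟩
    · exact Or.inl ⟨v, hvI, Prod.ext (by simp only [f₁, W, J]; rw [← h1, ← h2, hu]) rfl⟩
    · exact Or.inr ⟨v, hvI, Prod.ext (by simp only [f₂, W, J]; rw [← h1, ← h2, hu]) rfl⟩
  calc L.toFamily.size sh ≤ (I.image f₁ ∪ I.image f₂).card := by
        rw [← Set.ncard_coe_finset]
        exact Set.ncard_le_ncard hsub (Finset.finite_toSet _)
    _ ≤ I.card + I.card :=
        (Finset.card_union_le _ _).trans (add_le_add Finset.card_image_le Finset.card_image_le)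
    _ = 2 * N := by simp only [I, Nat.card_Ico]; omega

/-- Constants are gates of fan-in zero, so writing a constant matrix is free of work. -/
theorem size_eq_zero (L : Layer) (sh : Shape) (h : ∀ w j, ¬ L.active sh w j) :
    L.toFamily.size sh = 0 := by
  have : {e : ℕ × ℕ | L.toFamily.Wire sh e.1 e.2} = ∅ := by
    ext e
    simp only [Set.mem_ofPred_eq, Set.mem_empty_iff_false, iff_false]
    exact fun hw => h _ _ hw.2.1
  rw [CircuitFamily.size, this, Set.ncard_empty]

/-- The truth value of bit `j` of word `w` of the result. -/
def Output (L : Layer) (sh : Shape) (inp : ℕ → ℕ → Bool) (w j : ℕ) : Prop :=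
  match L.kind sh w j with
  | GateKind.and => ∀ a b, L.Source sh w j a b → inp a b = true
  | GateKind.or => ∃ a b, L.Source sh w j a b ∧ inp a b = true
  | GateKind.not => ∃ a b, L.Source sh w j a b ∧ inp a b = false

/-- Execution of a vector instruction needs a valuation of the nodes. As predecessors of gates are
input bits, it can be written down without recursion. -/
theorem exists_evaluates (L : Layer) (sh : Shape) (inp : ℕ → Bool) :
    ∃ val : ℕ → Bool, L.toFamily.Evaluates sh inp val ∧
      ∀ w < L.outLen sh, ∀ j < sh.width, (val (sh.numIn + w * sh.width + j) = true ↔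
        L.Output sh (fun a b => inp (a * sh.width + b)) w j) := by
  classical
  let out : ℕ → ℕ → Prop := L.Output sh fun a b => inp (a * sh.width + b)
  let val : ℕ → Bool := fun u => if u < sh.numIn then inp u else
    decide (out ((u - sh.numIn) / sh.width) ((u - sh.numIn) % sh.width))
  have hin : ∀ u, u < sh.numIn → val u = inp u := fun u hu => by simp [val, hu]
  have hout : ∀ v, sh.numIn ≤ v →
      (val v = true ↔ out ((v - sh.numIn) / sh.width) ((v - sh.numIn) % sh.width)) :=
    fun v hv => by simp [val, not_lt.2 hv]
  refine ⟨val, ⟨hin, fun v hv1 hv2 => ?_⟩, fun w hw j hj => ?_⟩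
  · rw [hout v hv1]
    have hB : 0 < sh.width := by
      rcases Nat.eq_zero_or_pos sh.width with h | h
      · simp [CircuitFamily.numNodes, toFamily, h] at hv2; omega
      · exact h
    set w := (v - sh.numIn) / sh.width with hw
    set j := (v - sh.numIn) % sh.width with hj
    have hwire : ∀ u, L.toFamily.Wire sh u v ↔ L.Source sh w j (u / sh.width) (u % sh.width) :=
      fun u => ⟨fun h => h.2, fun h => ⟨⟨hv1, hv2⟩, h⟩⟩
    have hval : ∀ u, L.Source sh w j (u / sh.width) (u % sh.width) →
        val u = inp (u / sh.width * sh.width + u % sh.width) := fun u h => by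
      rw [Nat.div_add_mod']
      exact hin u (div_lt_of_lt_numIn h.2.2.1 h.2.2.2)
    -- Nodes and pairs (word, bit) correspond to each other only for bit numbers below the width;
    -- `Source` guarantees this.
    have hdec : ∀ a b, b < sh.width →
        (a * sh.width + b) / sh.width = a ∧ (a * sh.width + b) % sh.width = b := fun a b hb => by
      rw [Nat.add_comm, Nat.add_mul_div_right _ _ hB, Nat.div_eq_of_lt hb,
        Nat.add_mul_mod_self_right, Nat.mod_eq_of_lt hb]
      simp
    have hval' : ∀ a b, L.Source sh w j a b →
        L.toFamily.Wire sh (a * sh.width + b) v ∧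
          val (a * sh.width + b) = inp (a * sh.width + b) := fun a b h => by
      obtain ⟨e1, e2⟩ := hdec a b h.2.2.2
      have := hval (a * sh.width + b) (by rw [e1, e2]; exact h)
      rw [e1, e2] at this
      exact ⟨(hwire _).2 (by rw [e1, e2]; exact h), this⟩
    have hk : L.toFamily.kind sh v = L.kind sh w j := rfl
    rw [hk]
    simp only [out, Output]
    cases L.kind sh w j
    · refine ⟨fun h u hu => ?_, fun h a b hab => ?_⟩
      · rw [hval u ((hwire u).1 hu)]; exact h _ _ ((hwire u).1 hu)
      · rw [← (hval' a b hab).2]; exact h _ (hval' a b hab).1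
    · refine ⟨fun ⟨a, b, hab, h⟩ => ⟨_, (hval' a b hab).1, ?_⟩, fun ⟨u, hu, h⟩ =>
        ⟨_, _, (hwire u).1 hu, ?_⟩⟩
      · rw [(hval' a b hab).2]; exact h
      · rw [← hval u ((hwire u).1 hu)]; exact h
    · refine ⟨fun ⟨a, b, hab, h⟩ => ⟨_, (hval' a b hab).1, ?_⟩, fun ⟨u, hu, h⟩ =>
        ⟨_, _, (hwire u).1 hu, ?_⟩⟩
      · rw [(hval' a b hab).2]; exact h
      · rw [← hval u ((hwire u).1 hu)]; exact h
  · rw [hout _ (by omega)]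
    have hB : 0 < sh.width := by omega
    have e : sh.numIn + w * sh.width + j - sh.numIn = j + w * sh.width := by omega
    rw [e, Nat.add_mul_div_right _ _ hB, Nat.div_eq_of_lt hj, Nat.add_mul_mod_self_right,
      Nat.mod_eq_of_lt hj, Nat.zero_add]

end Layer

/-- Word `i` of the concatenation of the `l₁` words from address `a₁` and the words from `a₂`. -/
def State.operandWord {B : ℕ} (σ : State B) (a₁ l₁ a₂ i : ℕ) : BitVec B :=
  if i < l₁ then σ.mem (a₁ + i) else σ.mem (a₂ + (i - l₁))

/-- The effect of the vector instruction that is described by a layer. -/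
theorem exec_layer (m : Machine) (L : Layer) (h₁ : L.NotUnique) (h₂ : L.Definable)
    (h₃ : ∃ c, ∀ sh : Shape, L.outLen sh ≤ (sh.len₁ + sh.len₂ + sh.width + sh.side + 2) ^ c)
    (a₁ l₁ a₂ l₂ d : ℕ) (σ : State m.width) (out : ℕ → BitVec m.width)
    (hout : ∀ w < L.outLen (m.shape (σ.reg l₁) (σ.reg l₂)), ∀ j < m.width,
      ((out w).getLsbD j = true ↔ L.Output (m.shape (σ.reg l₁) (σ.reg l₂))
        (fun a b => (σ.operandWord (σ.reg a₁) (σ.reg l₁) (σ.reg a₂) a).getLsbD b) w j)) :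
    Exec m (.vec (L.toInstr h₁ h₂ h₃) a₁ l₁ a₂ l₂ d) σ
      (σ.write (σ.reg d) (L.outLen (m.shape (σ.reg l₁) (σ.reg l₂))) out) 1
      (L.toFamily.size (m.shape (σ.reg l₁) (σ.reg l₂))) := by
  set sh := m.shape (σ.reg l₁) (σ.reg l₂) with hsh
  obtain ⟨val, hval, hv⟩ := L.exists_evaluates sh (σ.operandBit (σ.reg a₁) (σ.reg l₁) (σ.reg a₂))
  have hw : sh.width = m.width := rfl
  have key := Exec.vec (m := m) (L.toInstr h₁ h₂ h₃) a₁ l₁ a₂ l₂ d σ val hval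
  convert key using 1
  swap
  · rfl
  refine State.ext rfl (funext fun a => ?_)
  simp only [State.write]
  change (if σ.reg d ≤ a ∧ a < σ.reg d + L.outLen sh then _ else _) =
    if σ.reg d ≤ a ∧ a < σ.reg d + L.outLen sh then _ else _
  split_ifs with h
  · refine BitVec.eq_of_getLsbD_eq fun j hj => ?_
    rw [BitVec.getLsbD_ofFnLE, dif_pos hj, Bool.eq_iff_iff, hout _ (by omega) j hj]
    change _ ↔ val (sh.numIn + (a - σ.reg d) * sh.width + j) = true
    rw [hv _ (by omega) j hj]
    have hB : 0 < m.width := by omega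
    have hbit : ∀ a b, b < m.width →
        σ.operandBit (σ.reg a₁) (σ.reg l₁) (σ.reg a₂) (a * sh.width + b) =
          (σ.operandWord (σ.reg a₁) (σ.reg l₁) (σ.reg a₂) a).getLsbD b := fun a b hb => by
      rw [hw, State.operandBit, State.operandWord, Nat.add_comm, Nat.add_mul_div_right _ _ hB,
        Nat.div_eq_of_lt hb, Nat.add_mul_mod_self_right, Nat.mod_eq_of_lt hb, Nat.zero_add]
    simp only [Layer.Output]
    cases L.kind sh (a - σ.reg d) j
    · exact forall₂_congr fun a b => imp_congr_right fun h => by rw [hbit a b h.2.2.2]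
    · exact exists₂_congr fun a b => and_congr_right fun h => by rw [hbit a b h.2.2.2]
    · exact exists₂_congr fun a b => and_congr_right fun h => by rw [hbit a b h.2.2.2]
  · rfl

/-! ## The vector instructions of the multiplication program -/

/-- Bitwise complement of the words of the first operand. -/
noncomputable def complementLayer : Layer where
  outLen sh := sh.len₁
  kind _ _ _ := GateKind.not
  active _ _ _ := True
  word₁ _ w _ := w
  bit₁ _ _ j := j
  word₂ _ w _ := w
  bit₂ _ _ j := j

/-- The number of words of a group, when the `width` partial products of one component are divided
into `len₂` groups. -/
def Shape.groupSize (sh : Shape) : ℕ := (sh.width + sh.len₂ - 1) / sh.len₂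

/-- The number of groups that are stored in one row of the left factor. -/
def Shape.perRow (sh : Shape) : ℕ := sh.side / sh.groupSize

/-- The group that word `w` belongs to. -/
def Shape.group (sh : Shape) (w : ℕ) : ℕ :=
  w / sh.side * sh.perRow + w % sh.side / sh.groupSize

/-- The index of the partial product that is stored in word `w`. -/
def Shape.index (sh : Shape) (w : ℕ) : ℕ :=
  sh.group w % sh.len₂ * sh.groupSize + w % sh.side % sh.groupSize

/-- The number of low-order bits of the factors. -/
def Shape.half (sh : Shape) : ℕ := sh.width / 4

/-- Word `w` contains a partial product. -/
def Shape.IsProduct (sh : Shape) (w : ℕ) : Prop :=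
  w % sh.side / sh.groupSize < sh.perRow ∧ sh.group w < sh.len₁ / 3 * sh.len₂

/-- Bit `j` of word `w` of the matrix of partial products depends on the operands. -/
def expandActive (sh : Shape) (w j : ℕ) : Prop :=
  sh.IsProduct w ∧ ((sh.index w ≤ sh.half ∧ sh.index w ≤ j) ∨
    (sh.index w = sh.half + 1 ∧ j = sh.half))

open Classical in
/-- The partial products of the components of two vectors `x`, `y`. The first operand consists of
`x`, `y` and the complement of `x`, the length of the second operand is the number of groups into
which the partial products of a component are divided. -/
noncomputable def expandLayer : Layer where
  outLen sh := (sh.len₁ / 3 * sh.len₂ + sh.perRow - 1) / sh.perRow * sh.side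
  kind sh w j := if expandActive sh w j then GateKind.and else GateKind.or
  active := expandActive
  word₁ sh w _ := sh.len₁ / 3 + sh.group w / sh.len₂
  bit₁ sh w _ := if sh.index w ≤ sh.half then sh.index w else sh.half
  word₂ sh w _ := if sh.index w < sh.half then sh.group w / sh.len₂ else
    if sh.index w = sh.half then 2 * (sh.len₁ / 3) + sh.group w / sh.len₂ else
    sh.len₁ / 3 + sh.group w / sh.len₂
  bit₂ sh w j := if sh.index w ≤ sh.half then j - sh.index w else sh.half

open Classical in
/-- The `s × s` matrix which adds up groups of `len₁` consecutive entries of a row. -/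
noncomputable def blockLayer : Layer where
  outLen sh := sh.side * sh.side
  kind sh w j := if w / sh.side / sh.len₁ = w % sh.side ∧ j = 0 then GateKind.and else GateKind.or
  active _ _ _ := False
  word₁ _ _ _ := 0
  bit₁ _ _ _ := 0
  word₂ _ _ _ := 0
  bit₂ _ _ _ := 0

/-- Collects the first `side / len₂` words of each row. -/
noncomputable def compactLayer : Layer where
  outLen sh := sh.len₁ / sh.side
  kind _ _ _ := GateKind.and
  active _ _ _ := True
  word₁ sh w _ := w / (sh.side / sh.len₂) * sh.side + w % (sh.side / sh.len₂)
  bit₁ _ _ j := j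
  word₂ sh w _ := w / (sh.side / sh.len₂) * sh.side + w % (sh.side / sh.len₂)
  bit₂ _ _ j := j

/-! ### The four layers are legal vector instructions -/

theorem complementLayer_notUnique : complementLayer.NotUnique := by
  intro sh w j hw hj _
  refine ⟨w, j, fun a b => ?_⟩
  have : w < sh.len₁ := hw
  simp only [Layer.Source, complementLayer]
  constructor
  · rintro ⟨-, h | h, -⟩ <;> exact h
  · rintro ⟨rfl, rfl⟩
    exact ⟨trivial, Or.inl ⟨rfl, rfl⟩, by omega, hj⟩

/-- The condition is vacuous here and for the next two layers, since they contain no negations. This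
is why the complement of x is computed by a separate instruction. -/
theorem expandLayer_notUnique : expandLayer.NotUnique := by
  intro sh w j _ _ h
  simp only [expandLayer] at h
  split_ifs at h

theorem blockLayer_notUnique : blockLayer.NotUnique := by
  intro sh w j _ _ h
  simp only [blockLayer] at h
  split_ifs at h

theorem compactLayer_notUnique : compactLayer.NotUnique := by
  intro sh w j _ _ h
  cases h

theorem complementLayer_definable : complementLayer.Definable := by
  constructor <;> intros <;> simp only [complementLayer, reduceCtorEq] <;>
    first | assumption | exact BoundedArith.false' | exact BoundedArith.true'

theorem compactLayer_definable : compactLayer.Definable := by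
  have key : ∀ {k : ℕ} {b d w : (Fin k → ℕ) → ℕ}, BoundedFun b → BoundedFun d → BoundedFun w →
      BoundedFun fun v => w v / (d v / b v) * d v + w v % (d v / b v) :=
    fun hb hd hw => ((hw.div (hd.div hb)).mul hd).add (hw.mod (hd.div hb))
  constructor
  · exact fun ha _ _ hd => ha.div hd
  · exact fun _ _ _ _ _ _ => BoundedArith.true'.congr fun v => by simp [compactLayer]
  · exact fun _ _ _ _ _ _ => BoundedArith.false'.congr fun v => by simp [compactLayer]
  · exact fun _ _ _ _ _ _ => BoundedArith.true'
  · exact fun _ hb _ hd hw _ => key hb hd hw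
  · exact fun _ _ _ _ _ hj => hj
  · exact fun _ hb _ hd hw _ => key hb hd hw
  · exact fun _ _ _ _ _ hj => hj

theorem blockLayer_definable : blockLayer.Definable := by
  have key : ∀ {k : ℕ} {a d w j : (Fin k → ℕ) → ℕ}, BoundedFun a → BoundedFun d → BoundedFun w →
      BoundedFun j → BoundedArith fun v => w v / d v / a v = w v % d v ∧ j v = 0 :=
    fun ha hd hw hj => (((hw.div hd).div ha).eq (hw.mod hd)).and (hj.eq (.const 0))
  constructor
  · exact fun _ _ _ hd => hd.mul hd
  · exact fun ha _ _ hd hw hj => (key ha hd hw hj).congr fun v => by simp [blockLayer]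
  · exact fun ha _ _ hd hw hj => (key ha hd hw hj).not.congr fun v => by simp [blockLayer]
  · exact fun _ _ _ _ _ _ => BoundedArith.false'
  all_goals exact fun _ _ _ _ _ _ => .const 0

section

variable {k : ℕ} {a b c d w j : (Fin k → ℕ) → ℕ}

theorem boundedFun_groupSize (hb : BoundedFun b) (hc : BoundedFun c) :
    BoundedFun fun v => Shape.groupSize ⟨a v, b v, c v, d v⟩ :=
  ((hc.add hb).sub (.const 1)).div hb

theorem boundedFun_perRow (hb : BoundedFun b) (hc : BoundedFun c) (hd : BoundedFun d) :
    BoundedFun fun v => Shape.perRow ⟨a v, b v, c v, d v⟩ :=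
  hd.div (boundedFun_groupSize (a := a) (d := d) hb hc)

theorem boundedFun_group (hb : BoundedFun b) (hc : BoundedFun c) (hd : BoundedFun d)
    (hw : BoundedFun w) : BoundedFun fun v => Shape.group ⟨a v, b v, c v, d v⟩ (w v) :=
  ((hw.div hd).mul (boundedFun_perRow hb hc hd)).add
    ((hw.mod hd).div (boundedFun_groupSize (a := a) (d := d) hb hc))

theorem boundedFun_index (hb : BoundedFun b) (hc : BoundedFun c) (hd : BoundedFun d)
    (hw : BoundedFun w) : BoundedFun fun v => Shape.index ⟨a v, b v, c v, d v⟩ (w v) :=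
  (((boundedFun_group (a := a) hb hc hd hw).mod hb).mul
    (boundedFun_groupSize (a := a) (d := d) hb hc)).add
      ((hw.mod hd).mod (boundedFun_groupSize (a := a) (d := d) hb hc))

theorem boundedFun_half (hc : BoundedFun c) :
    BoundedFun fun v => Shape.half ⟨a v, b v, c v, d v⟩ :=
  hc.div (.const 4)

theorem boundedArith_expandActive (ha : BoundedFun a) (hb : BoundedFun b) (hc : BoundedFun c)
    (hd : BoundedFun d) (hw : BoundedFun w) (hj : BoundedFun j) :
    BoundedArith fun v => expandActive ⟨a v, b v, c v, d v⟩ (w v) (j v) := by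
  have hg := boundedFun_group (a := a) hb hc hd hw
  have hi := boundedFun_index (a := a) hb hc hd hw
  have hh := boundedFun_half (a := a) (b := b) (d := d) hc
  exact ((((hw.mod hd).div (boundedFun_groupSize (a := a) (d := d) hb hc)).lt
    (boundedFun_perRow hb hc hd)).and (hg.lt ((ha.div (.const 3)).mul hb))).and
    (((hi.le hh).and (hi.le hj)).or ((hi.eq (hh.add (.const 1))).and (hj.eq hh)))

end

theorem expandLayer_definable : expandLayer.Definable := by
  constructor
  · intro k a b c d ha hb hc hd
    have hp := boundedFun_perRow (a := a) hb hc hd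
    exact ((((ha.div (.const 3)).mul hb).add hp |>.sub (.const 1)).div hp).mul hd
  · exact fun ha hb hc hd hw hj => (boundedArith_expandActive ha hb hc hd hw hj).congr fun v => by
      simp [expandLayer]
  · exact fun ha hb hc hd hw hj => (boundedArith_expandActive ha hb hc hd hw hj).not.congr
      fun v => by simp [expandLayer]
  · exact boundedArith_expandActive
  · intro k a b c d w j ha hb hc hd hw hj
    exact (ha.div (.const 3)).add ((boundedFun_group (a := a) hb hc hd hw).div hb)
  · intro k a b c d w j ha hb hc hd hw hj
    have hi := boundedFun_index (a := a) hb hc hd hw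
    have hh := boundedFun_half (a := a) (b := b) (d := d) hc
    exact BoundedFun.ite (hi.le hh) hi hh
  · intro k a b c d w j ha hb hc hd hw hj
    have hi := boundedFun_index (a := a) hb hc hd hw
    have hh := boundedFun_half (a := a) (b := b) (d := d) hc
    have hg := (boundedFun_group (a := a) hb hc hd hw).div hb
    have hn := ha.div (BoundedFun.const 3)
    exact BoundedFun.ite (hi.lt hh) hg
      (BoundedFun.ite (hi.eq hh) (((BoundedFun.const 2).mul hn).add hg) (hn.add hg))
  · intro k a b c d w j ha hb hc hd hw hj
    have hi := boundedFun_index (a := a) hb hc hd hw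
    have hh := boundedFun_half (a := a) (b := b) (d := d) hc
    exact BoundedFun.ite (hi.le hh) (hj.sub hi) hh

theorem complementLayer_outLen_le : ∃ c, ∀ sh : Shape,
    complementLayer.outLen sh ≤ (sh.len₁ + sh.len₂ + sh.width + sh.side + 2) ^ c :=
  ⟨1, fun sh => by simp only [complementLayer, pow_one]; omega⟩

theorem compactLayer_outLen_le : ∃ c, ∀ sh : Shape,
    compactLayer.outLen sh ≤ (sh.len₁ + sh.len₂ + sh.width + sh.side + 2) ^ c :=
  ⟨1, fun sh => by
    have := Nat.div_le_self sh.len₁ sh.side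
    simp only [compactLayer, pow_one]; omega⟩

theorem blockLayer_outLen_le : ∃ c, ∀ sh : Shape,
    blockLayer.outLen sh ≤ (sh.len₁ + sh.len₂ + sh.width + sh.side + 2) ^ c :=
  ⟨2, fun sh => by
    rw [pow_two]
    exact Nat.mul_le_mul (by omega) (by omega)⟩

theorem expandLayer_outLen_le : ∃ c, ∀ sh : Shape,
    expandLayer.outLen sh ≤ (sh.len₁ + sh.len₂ + sh.width + sh.side + 2) ^ c := by
  refine ⟨4, fun sh => ?_⟩
  set S := sh.len₁ + sh.len₂ + sh.width + sh.side + 2 with hS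
  have h1 : sh.len₁ / 3 * sh.len₂ ≤ S * S :=
    Nat.mul_le_mul ((Nat.div_le_self _ _).trans (by omega)) (by omega)
  have h2 : sh.perRow ≤ S := (Nat.div_le_self _ _).trans (by omega)
  have h3 : (sh.len₁ / 3 * sh.len₂ + sh.perRow - 1) / sh.perRow ≤ S ^ 3 := by
    refine (Nat.div_le_self _ _).trans ?_
    have : 2 ≤ S := by omega
    nlinarith [Nat.mul_le_mul this (le_refl (S * S)), Nat.mul_le_mul this (le_refl S),
      Nat.sub_le (sh.len₁ / 3 * sh.len₂ + sh.perRow) 1]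
  calc _ ≤ S ^ 3 * S := Nat.mul_le_mul h3 (by omega)
    _ = S ^ 4 := (pow_succ _ _).symm

/-- Bitwise complement. -/
noncomputable def complementInstr : VecInstr :=
  complementLayer.toInstr complementLayer_notUnique complementLayer_definable
    complementLayer_outLen_le

/-- The partial products of the components of two vectors. -/
noncomputable def expandInstr : VecInstr :=
  expandLayer.toInstr expandLayer_notUnique expandLayer_definable expandLayer_outLen_le

/-- The matrix which adds up groups of entries of a row. -/
noncomputable def blockInstr : VecInstr :=
  blockLayer.toInstr blockLayer_notUnique blockLayer_definable blockLayer_outLen_le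

/-- Collects the first words of each row. -/
noncomputable def compactInstr : VecInstr :=
  compactLayer.toInstr compactLayer_notUnique compactLayer_definable compactLayer_outLen_le

/-- The partial product with index `j` of two numbers whose factor `y` has `h` low-order bits, where
`x'` is the complement of `x`. -/
def partialProduct {B : ℕ} (h : ℕ) (x x' y : BitVec B) (j : ℕ) : BitVec B :=
  if j < h then if y.getLsbD j then x <<< j else 0
  else if j = h then if y.getLsbD h then x' <<< h else 0
  else if j = h + 1 then if y.getLsbD h then 1#B <<< h else 0
  else 0

/-! ### Effects of the four vector instructions -/

theorem exec_complement (m : Machine) (a₁ l₁ a₂ l₂ d : ℕ) (σ : State m.width) :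
    ∃ w : ℕ, w ≤ 2 * (σ.reg l₁ * m.width) ∧
      Exec m (.vec complementInstr a₁ l₁ a₂ l₂ d) σ
        (σ.write (σ.reg d) (σ.reg l₁) fun i => ~~~σ.mem (σ.reg a₁ + i)) 1 w := by
  refine ⟨_, Layer.size_le _ _, exec_layer m complementLayer _ _ _ a₁ l₁ a₂ l₂ d σ _ ?_⟩
  intro w hw j hj
  have hw' : w < σ.reg l₁ := hw
  simp only [Layer.Output, complementLayer, Layer.Source, Machine.shape]
  rw [BitVec.getLsbD_not]
  simp only [hj, decide_true, Bool.true_and, Bool.not_eq_true']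
  constructor
  · exact fun h => ⟨w, j, ⟨trivial, Or.inl ⟨rfl, rfl⟩, by omega, hj⟩, by
      simpa [State.operandWord, hw'] using h⟩
  · rintro ⟨a, b, ⟨-, h | h, -⟩, hab⟩ <;> obtain ⟨rfl, rfl⟩ := h <;>
      simpa [State.operandWord, hw'] using hab

/-- An empty conjunction in bit 0 is the word 1, and empty disjunctions are zeros; no wires are
needed. The group size reaches the circuit as the length of an operand whose content is ignored,
because circuits depend on nothing but the shape. -/
theorem exec_block (m : Machine) (hB : 2 ≤ m.width) (a₁ l₁ a₂ l₂ d : ℕ) (σ : State m.width) :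
    Exec m (.vec blockInstr a₁ l₁ a₂ l₂ d) σ
      (σ.write (σ.reg d) (m.s * m.s) fun i =>
        if i / m.s / σ.reg l₁ = i % m.s then 1 else 0) 1 0 := by
  have key := exec_layer m blockLayer blockLayer_notUnique blockLayer_definable
    blockLayer_outLen_le a₁ l₁ a₂ l₂ d σ
    (fun i => if i / m.s / σ.reg l₁ = i % m.s then 1 else 0) ?_
  · rw [Layer.size_eq_zero blockLayer _ fun _ _ h => h, Nat.cast_zero] at key
    exact key
  · intro w hw j hj
    simp only [Layer.Output, blockLayer, Layer.Source, Machine.shape, false_and]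
    by_cases h1 : w / m.s / σ.reg l₁ = w % m.s <;> by_cases h2 : j = 0 <;>
      simp [h1, h2]
    omega

/-- The operand length U·s is chosen to make the output length U. It may exceed the length of the
matrix, but the source of an output word lies in an earlier or equal row number, hence within the
operand. -/
theorem exec_compact (m : Machine) (a₁ l₁ a₂ l₂ d : ℕ) (σ : State m.width) {U : ℕ}
    (hs : 0 < m.s) (hU : σ.reg l₁ = U * m.s) (hg : 0 < m.s / σ.reg l₂) :
    ∃ w : ℕ, w ≤ 2 * (U * m.width) ∧
      Exec m (.vec compactInstr a₁ l₁ a₂ l₂ d) σ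
        (σ.write (σ.reg d) U fun i =>
          σ.mem (σ.reg a₁ + (i / (m.s / σ.reg l₂) * m.s + i % (m.s / σ.reg l₂)))) 1 w := by
  have hlen : compactLayer.outLen (m.shape (σ.reg l₁) (σ.reg l₂)) = U := by
    simp only [compactLayer, Machine.shape, hU]
    exact Nat.mul_div_cancel _ hs
  have key := exec_layer m compactLayer compactLayer_notUnique compactLayer_definable
    compactLayer_outLen_le a₁ l₁ a₂ l₂ d σ (fun i =>
      σ.mem (σ.reg a₁ + (i / (m.s / σ.reg l₂) * m.s + i % (m.s / σ.reg l₂)))) ?_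
  · have hsize := Layer.size_le compactLayer (m.shape (σ.reg l₁) (σ.reg l₂))
    rw [hlen] at key hsize
    exact ⟨_, hsize, key⟩
  · intro w hw j hj
    rw [hlen] at hw
    set g := m.s / σ.reg l₂ with hgdef
    have hlt : w / g * m.s + w % g < σ.reg l₁ := by
      have h1 : w % g < m.s := (Nat.mod_lt _ hg).trans_le (Nat.div_le_self _ _)
      have h2 : w / g + 1 ≤ U := (Nat.succ_le_succ (Nat.div_le_self _ _)).trans hw
      have h3 := Nat.mul_le_mul_right m.s h2
      rw [hU]
      rw [Nat.add_mul] at h3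
      omega
    simp only [Layer.Output, compactLayer, Layer.Source, Machine.shape, ← hgdef, or_self]
    constructor
    · rintro h a b ⟨-, ⟨rfl, rfl⟩, -⟩
      simpa [State.operandWord, hlt] using h
    · intro h
      simpa [State.operandWord, hlt] using h _ _ ⟨trivial, ⟨rfl, rfl⟩, by omega, hj⟩

/-- The operand contains x, y and the complement of x, n words each. The content of the second
operand is never read; its length conveys the number of groups per component. -/
theorem exec_expand (m : Machine) (a₁ l₁ a₂ l₂ d : ℕ) (σ : State m.width) {n : ℕ} {sh : Shape}
    (hsh : sh = ⟨σ.reg l₁, σ.reg l₂, m.width, m.s⟩) (hn : σ.reg l₁ = 3 * n) :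
    ∃ w : ℕ, w ≤ 2 * ((n * sh.len₂ + sh.perRow - 1) / sh.perRow * m.s * m.width) ∧
      Exec m (.vec expandInstr a₁ l₁ a₂ l₂ d) σ
        (σ.write (σ.reg d) ((n * sh.len₂ + sh.perRow - 1) / sh.perRow * m.s) fun i =>
          if i % m.s / sh.groupSize < sh.perRow ∧ sh.group i < n * sh.len₂ then
            partialProduct (m.width / 4) (σ.mem (σ.reg a₁ + sh.group i / sh.len₂))
              (σ.mem (σ.reg a₁ + (2 * n + sh.group i / sh.len₂)))
              (σ.mem (σ.reg a₁ + (n + sh.group i / sh.len₂))) (sh.index i)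
          else 0) 1 w := by
  have hshm : m.shape (σ.reg l₁) (σ.reg l₂) = sh := hsh.symm
  have h3 : sh.len₁ / 3 = n := by rw [hsh]; dsimp only; omega
  have hlen : expandLayer.outLen sh = (n * sh.len₂ + sh.perRow - 1) / sh.perRow * m.s := by
    simp only [expandLayer, h3]
    rw [hsh]
  have key := exec_layer m expandLayer expandLayer_notUnique expandLayer_definable
    expandLayer_outLen_le a₁ l₁ a₂ l₂ d σ (fun i =>
          if i % m.s / sh.groupSize < sh.perRow ∧ sh.group i < n * sh.len₂ then
            partialProduct (m.width / 4) (σ.mem (σ.reg a₁ + sh.group i / sh.len₂))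
              (σ.mem (σ.reg a₁ + (2 * n + sh.group i / sh.len₂)))
              (σ.mem (σ.reg a₁ + (n + sh.group i / sh.len₂))) (sh.index i)
          else 0) ?_
  · have hsize := Layer.size_le expandLayer sh
    rw [hshm] at key
    rw [hlen] at key hsize
    have hwd : sh.width = m.width := by rw [hsh]
    rw [hwd] at hsize
    exact ⟨_, hsize, key⟩
  · rw [hshm]
    intro i _ b hb
    have hwd : sh.width = m.width := by rw [hsh]
    have hsd : sh.side = m.s := by rw [hsh]
    have hh : sh.half = m.width / 4 := by rw [Shape.half, hwd]
    set h := m.width / 4 with hhdef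
    have hhB : h < m.width := by omega
    set j := sh.index i with hj
    set u := sh.group i with hu
    have hvalid : sh.IsProduct i ↔ i % m.s / sh.groupSize < sh.perRow ∧ u < n * sh.len₂ := by
      rw [Shape.IsProduct, h3, hsd]
    have hop : ∀ a < σ.reg l₁, σ.operandWord (σ.reg a₁) (σ.reg l₁) (σ.reg a₂) a =
        σ.mem (σ.reg a₁ + a) := fun a ha => by simp [State.operandWord, ha]
    -- Padding, at the end of a row or after the last group, consists of empty disjunctions and is
    -- therefore zero.
    by_cases hv : sh.IsProduct i
    swap
    · have : ¬ expandActive sh i b := fun h => hv h.1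
      rw [if_neg (hvalid.not.1 hv)]
      simp [Layer.Output, expandLayer, this, Layer.Source]
    have hq : u / sh.len₂ < n := by
      have := hv.2
      rw [h3] at this
      exact Nat.div_lt_of_lt_mul (by rwa [Nat.mul_comm])
    set q := u / sh.len₂ with hqdef
    have o1 := hop q (by omega)
    have o2 := hop (2 * n + q) (by omega)
    have o3 := hop (n + q) (by omega)
    rw [if_pos (hvalid.1 hv)]
    -- Active bits are conjunctions of a bit of y with a bit of x, of its complement, or with the
    -- same bit of y again. Inactive bits are zero because of the shift or because the index exceeds
    -- h + 1.
    by_cases hact : expandActive sh i b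
    · have hout : expandLayer.Output sh
          (fun a b => (σ.operandWord (σ.reg a₁) (σ.reg l₁) (σ.reg a₂) a).getLsbD b) i b ↔
          (σ.operandWord (σ.reg a₁) (σ.reg l₁) (σ.reg a₂) (expandLayer.word₁ sh i b)).getLsbD
            (expandLayer.bit₁ sh i b) = true ∧
          (σ.operandWord (σ.reg a₁) (σ.reg l₁) (σ.reg a₂) (expandLayer.word₂ sh i b)).getLsbD
            (expandLayer.bit₂ sh i b) = true := by
        have hk : expandLayer.kind sh i b = GateKind.and := by simp [expandLayer, hact]
        have r1 : expandLayer.word₁ sh i b < sh.len₁ + sh.len₂ := by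
          simp only [expandLayer, h3, ← hu, ← hqdef]; omega
        have r2 : expandLayer.word₂ sh i b < sh.len₁ + sh.len₂ := by
          simp only [expandLayer, h3, ← hu, ← hqdef]; split_ifs <;> omega
        have r3 : expandLayer.bit₁ sh i b < sh.width := by
          simp only [expandLayer, hh, ← hj]; split_ifs <;> omega
        have r4 : expandLayer.bit₂ sh i b < sh.width := by
          simp only [expandLayer, hh, ← hj]; split_ifs <;> omega
        simp only [Layer.Output, hk, Layer.Source]
        constructor
        · exact fun H => ⟨H _ _ ⟨hact, Or.inl ⟨rfl, rfl⟩, r1, r3⟩,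
            H _ _ ⟨hact, Or.inr ⟨rfl, rfl⟩, r2, r4⟩⟩
        · rintro ⟨H1, H2⟩ a b ⟨-, ⟨rfl, rfl⟩ | ⟨rfl, rfl⟩, -⟩
          · exact H1
          · exact H2
      rw [hout]
      simp only [expandLayer, h3, hh, ← hu, ← hqdef, ← hj, o3]
      have hact' := hact.2
      rw [hh, ← hj] at hact'
      simp only [partialProduct]
      rcases hact' with ⟨ha1, ha2⟩ | ⟨ha1, ha2⟩
      · rcases ha1.lt_or_eq with hlt | heq
        · simp only [hlt, ha1, if_true, o1]
          cases hy : (σ.mem (σ.reg a₁ + (n + q))).getLsbD j <;>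
            simp [hb, not_lt.2 ha2, -BitVec.getLsbD_eq_getElem]
        · simp only [heq, lt_irrefl, le_refl, if_true, if_false, o2]
          rw [heq] at ha2
          cases hy : (σ.mem (σ.reg a₁ + (n + q))).getLsbD h <;>
            simp [hb, not_lt.2 ha2, -BitVec.getLsbD_eq_getElem]
      · have e1 : ¬ j < h := by omega
        have e2 : ¬ j = h := by omega
        have e3 : ¬ j ≤ h := by omega
        simp only [if_neg e1, if_neg e2, if_neg e3, if_pos ha1, o3]
        cases hy : (σ.mem (σ.reg a₁ + (n + q))).getLsbD h <;>
          simp [ha2, hhB, -BitVec.getLsbD_eq_getElem]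
        omega
    · have hout : ¬ expandLayer.Output sh
          (fun a b => (σ.operandWord (σ.reg a₁) (σ.reg l₁) (σ.reg a₂) a).getLsbD b) i b := by
        simp [Layer.Output, expandLayer, hact, Layer.Source]
      refine iff_of_false ?_ hout
      have hact' : ¬ ((j ≤ h ∧ j ≤ b) ∨ (j = h + 1 ∧ b = h)) := fun H =>
        hact ⟨hv, by rw [hh, ← hj]; exact H⟩
      simp only [partialProduct]
      split_ifs with c1 c2 c3 c4 c5 c6
      · have : b < j := by omega
        simp [this]
      · simp
      · have : b < h := by omega
        simp [this]
      · simp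
      · have : b ≠ h := by omega
        simp only [BitVec.getLsbD_shiftLeft, BitVec.getLsbD_one]
        simp
        omega
      · simp
      · simp

/-! ## Values of the partial products -/

theorem toInt_ofInt_of_fits {B : ℕ} {z : ℤ} (h : Fits B z) (hB : 0 < B) :
    (BitVec.ofInt B z).toInt = z := by
  obtain ⟨b, rfl⟩ := Nat.exists_eq_succ_of_ne_zero hB.ne'
  obtain ⟨h1, h2⟩ := h
  simp only [Nat.succ_eq_add_one, Nat.add_sub_cancel] at h1 h2
  rw [BitVec.toInt_ofInt]
  apply Int.bmod_eq_of_le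
  · push_cast; rw [pow_succ]; omega
  · push_cast; rw [pow_succ]; omega

theorem fits_of_abs_le {B : ℕ} {z b : ℤ} (h : |z| ≤ b) (hb : b < 2 ^ (B - 1)) : Fits B z := by
  have := abs_le.1 h
  exact ⟨by linarith, by linarith⟩

/-- Reduction modulo 2^B changes Y by a multiple of 2^(j+1), which does not affect bit j. Division
rounds down, so this is also correct for negative Y. -/
theorem getLsbD_ofInt_iff {B j : ℕ} (Y : ℤ) (hj : j < B) :
    (BitVec.ofInt B Y).getLsbD j = true ↔ Y / 2 ^ j % 2 = 1 := by
  rw [BitVec.getLsbD, BitVec.toNat_ofInt, Nat.testBit_eq_decide_div_mod_eq, decide_eq_true_iff]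
  have hpos : (0 : ℤ) < 2 ^ B := by positivity
  have h0 : 0 ≤ Y % 2 ^ B := Int.emod_nonneg _ hpos.ne'
  have key : (Y % 2 ^ B) / 2 ^ j % 2 = Y / 2 ^ j % 2 := by
    obtain ⟨d, rfl⟩ : ∃ d, B = j + (d + 1) := ⟨B - j - 1, by omega⟩
    have h1 := Int.emod_add_mul_ediv Y (2 ^ (j + (d + 1)))
    set q := Y / 2 ^ (j + (d + 1))
    set r := Y % 2 ^ (j + (d + 1))
    have h2 : Y = r + 2 ^ j * (2 * (2 ^ d * q)) := by rw [← h1]; ring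
    rw [h2, Int.add_mul_ediv_left _ _ (by positivity), Int.add_mul_emod_self_left]
  rw [← key]
  constructor
  · intro h
    have := congrArg (Nat.cast : ℕ → ℤ) h
    push_cast [Int.toNat_of_nonneg h0] at this
    exact this
  · intro h
    have : (((Y % ((2 ^ B : ℕ) : ℤ)).toNat / 2 ^ j % 2 : ℕ) : ℤ) = 1 := by
      push_cast [Int.toNat_of_nonneg h0]
      exact h
    exact_mod_cast this

/-- Each step of the induction splits the lowest bit off Y / 2^h. No sign condition on Y is needed.
-/
theorem sum_bits (Y : ℤ) (h : ℕ) :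
    ∑ j ∈ Finset.range h, Y / 2 ^ j % 2 * 2 ^ j = Y % 2 ^ h := by
  induction h with
  | zero => simp
  | succ h ih =>
    rw [Finset.sum_range_succ, ih]
    have h1 := Int.emod_add_mul_ediv Y (2 ^ h)
    have h2 := Int.emod_add_mul_ediv (Y / 2 ^ h) 2
    have h3 := Int.emod_add_mul_ediv Y (2 ^ (h + 1))
    rw [pow_succ, ← Int.ediv_ediv_of_nonneg (by positivity)] at h3
    rw [pow_succ]
    linear_combination h1 - h3 + 2 ^ h * h2

/-- The value of the partial product with index `j` of `X` and `Y`. -/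
def partialValue (h : ℕ) (X Y : ℤ) (j : ℕ) : ℤ :=
  if j < h then X * (Y / 2 ^ j % 2 * 2 ^ j)
  else if j = h then (-X - 1) * (Y / 2 ^ h % 2 * 2 ^ h)
  else if j = h + 1 then Y / 2 ^ h % 2 * 2 ^ h
  else 0

/-- Stated for a general `f` with `f 0 = 0`, to be used both for the sum of the values and for the
sum of their absolute values. -/
theorem sum_range_partialValue {h N : ℕ} (hN : h + 2 ≤ N) {X Y : ℤ} {α : Type*}
    [AddCommMonoid α] (f : ℤ → α) (h0 : f 0 = 0) :
    ∑ j ∈ Finset.range N, f (partialValue h X Y j) =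
      ∑ j ∈ Finset.range h, f (X * (Y / 2 ^ j % 2 * 2 ^ j)) +
        f ((-X - 1) * (Y / 2 ^ h % 2 * 2 ^ h)) + f (Y / 2 ^ h % 2 * 2 ^ h) := by
  rw [← Finset.sum_subset (Finset.range_mono hN), Finset.sum_range_succ, Finset.sum_range_succ]
  · congr 1
    · congr 1
      · refine Finset.sum_congr rfl fun j hj => ?_
        rw [partialValue, if_pos (Finset.mem_range.1 hj)]
      · simp [partialValue]
    · simp [partialValue]
  · intro j _ hj
    have : h + 2 ≤ j := by simpa using hj
    rw [partialValue, if_neg (by omega), if_neg (by omega), if_neg (by omega), h0]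

/-- The low bits contribute X·(Y mod 2^h), and the last two terms together -X·y_h·2^h. By the bound
on Y, the quotient Y / 2^h is 0 or -1, so y_h is its negative and the two contributions add up to
X·Y. -/
theorem sum_partialValue {h N : ℕ} (hN : h + 2 ≤ N) {X Y : ℤ} (hY : |Y| < 2 ^ h) :
    ∑ j ∈ Finset.range N, partialValue h X Y j = X * Y := by
  rw [sum_range_partialValue hN (fun z => z) rfl, ← Finset.mul_sum, sum_bits]
  obtain ⟨h1, h2⟩ := abs_lt.1 hY
  have hpos : (0 : ℤ) < 2 ^ h := by positivity
  have e := Int.emod_add_mul_ediv Y (2 ^ h)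
  rcases le_or_gt 0 Y with hy | hy
  · have : Y / 2 ^ h = 0 := Int.ediv_eq_zero_of_lt hy h2
    rw [this] at e ⊢
    simp only [EuclideanDomain.zero_mod, zero_mul, mul_zero, add_zero] at e ⊢
    rw [e]
  · have : Y / 2 ^ h = -1 := by
      rw [Int.ediv_eq_iff_of_pos hpos]
      constructor <;> linarith
    rw [this] at e ⊢
    norm_num at e ⊢
    linear_combination X * e

theorem abs_bit_le (Y : ℤ) (j : ℕ) : |Y / 2 ^ j % 2 * 2 ^ j| ≤ 2 ^ j := by
  have h1 := Int.emod_nonneg (Y / 2 ^ j) (by norm_num : (2 : ℤ) ≠ 0)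
  have h2 := Int.emod_lt_of_pos (Y / 2 ^ j) (by norm_num : (0 : ℤ) < 2)
  have h3 : (0 : ℤ) < 2 ^ j := by positivity
  rw [abs_of_nonneg (by positivity)]
  nlinarith

/-- The terms are at most |X|(2^h - 1), (|X| + 1)2^h and 2^h. With |X| ≤ 2^h - 1 this gives 2·4^h -
2^h + 1. -/
theorem sum_abs_partialValue {h N : ℕ} (hN : h + 2 ≤ N) {X Y : ℤ} (hX : |X| < 2 ^ h) :
    ∑ j ∈ Finset.range N, |partialValue h X Y j| ≤ 2 ^ (2 * h + 1) := by
  rw [sum_range_partialValue hN (fun z => |z|) abs_zero]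
  have hX0 := abs_nonneg X
  have hp : (0 : ℤ) < 2 ^ h := by positivity
  have h1 : ∑ j ∈ Finset.range h, |X * (Y / 2 ^ j % 2 * 2 ^ j)| ≤ |X| * (2 ^ h - 1) := by
    have hg : ∑ j ∈ Finset.range h, (2 : ℤ) ^ j = 2 ^ h - 1 := by
      have := geom_sum_mul (2 : ℤ) h
      linarith
    rw [← hg, Finset.mul_sum]
    refine Finset.sum_le_sum fun j _ => ?_
    rw [abs_mul]
    exact mul_le_mul_of_nonneg_left (abs_bit_le Y j) hX0
  have hb := abs_bit_le Y h
  have h2 : |(-X - 1) * (Y / 2 ^ h % 2 * 2 ^ h)| ≤ (|X| + 1) * 2 ^ h := by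
    rw [abs_mul]
    refine mul_le_mul ?_ hb (abs_nonneg _) (by linarith)
    have := abs_sub (-X) 1
    rwa [abs_neg, abs_one] at this
  have e : (2 : ℤ) ^ (2 * h + 1) = 2 * (2 ^ h * 2 ^ h) := by ring
  rw [e]
  nlinarith

/-- Shift, complement and masking agree with the integer operations modulo 2^B. The integer value is
small enough to be recovered from its residue. -/
theorem toInt_partialProduct {B h : ℕ} (hB : 2 * h + 3 ≤ B) {X Y : ℤ} (hX : |X| < 2 ^ h) (j : ℕ) :
    (partialProduct h (BitVec.ofInt B X) (~~~BitVec.ofInt B X) (BitVec.ofInt B Y) j).toInt =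
      partialValue h X Y j := by
  have hnot : ~~~BitVec.ofInt B X = BitVec.ofInt B (-X - 1) := by
    rw [BitVec.not_eq_neg_add]
    apply BitVec.eq_of_toInt_eq
    have h1 : (1#B).toInt = 1 := BitVec.toInt_one (by omega)
    simp [BitVec.toInt_sub, BitVec.toInt_neg, BitVec.toInt_ofInt, h1]
  have hshift : ∀ (Z : ℤ) (i : ℕ), BitVec.ofInt B Z <<< i = BitVec.ofInt B (Z * 2 ^ i) := by
    intro Z i
    rw [BitVec.shiftLeft_eq_mul_twoPow, BitVec.ofInt_mul]
    congr 1
    apply BitVec.eq_of_toNat_eq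
    rw [BitVec.toNat_twoPow, BitVec.toNat_ofInt]
    norm_cast
  have hone : (1#B) = BitVec.ofInt B 1 := rfl
  have hzero : (0 : BitVec B) = BitVec.ofInt B 0 := rfl
  have hbit : ∀ i < B, ∀ Z : ℤ, (if (BitVec.ofInt B Y).getLsbD i then
      BitVec.ofInt B (Z * 2 ^ i) else 0) = BitVec.ofInt B (Z * (Y / 2 ^ i % 2 * 2 ^ i)) := by
    intro i hi Z
    have := Int.emod_two_eq_zero_or_one (Y / 2 ^ i)
    by_cases hb : (BitVec.ofInt B Y).getLsbD i = true
    · rw [if_pos hb, (getLsbD_ofInt_iff Y hi).1 hb, one_mul]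
    · rw [if_neg hb]
      have h0 := mt (getLsbD_ofInt_iff Y hi).2 hb
      have : Y / 2 ^ i % 2 = 0 := by omega
      rw [this, hzero, zero_mul, mul_zero]
  have hval : partialProduct h (BitVec.ofInt B X) (~~~BitVec.ofInt B X) (BitVec.ofInt B Y) j =
      BitVec.ofInt B (partialValue h X Y j) := by
    rw [partialProduct, partialValue, hnot, hone]
    simp only [hshift]
    split_ifs with h1 h2 h3 h4 h5 h6
    · rw [← hbit j (by omega), if_pos h2]
    · rw [← hbit j (by omega), if_neg h2]
    · rw [← hbit h (by omega), if_pos h4]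
    · rw [← hbit h (by omega), if_neg h4]
    · rw [← one_mul (Y / 2 ^ h % 2 * 2 ^ h), ← hbit h (by omega), if_pos h6]
    · rw [← one_mul (Y / 2 ^ h % 2 * 2 ^ h), ← hbit h (by omega), if_neg h6]
    · rfl
  rw [hval]
  refine toInt_ofInt_of_fits (fits_of_abs_le (b := 2 ^ (2 * h + 1)) ?_ ?_) (by omega)
  -- A single value is bounded by the sum of all absolute values, taken over a range long enough to
  -- contain `j`.
  · refine le_trans ?_ (sum_abs_partialValue (N := h + 2 + j + 1) (Y := Y) (by omega) hX)
    exact Finset.single_le_sum (f := fun i => |partialValue h X Y i|) (fun i _ => abs_nonneg _)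
      (Finset.mem_range.2 (by omega))
  · exact pow_lt_pow_right₀ (by norm_num) (by omega)

/-! ## One round of summation -/

/-- Column j of the 0/1 matrix selects the c positions of group j. For j < g they all lie in the
row, because g·c ≤ s; the other columns meet only zeros of the left factor. -/
theorem sum_block {s c g U r j : ℕ} (hg : g = s / c) (a : ℕ → ℕ → ℤ) :
    ∑ k ∈ Finset.range s, (if k / c < g ∧ r * g + k / c < U then a (r * g + k / c) (k % c) else 0) *
        (if k / c = j then 1 else 0) =
      if j < g ∧ r * g + j < U then ∑ k ∈ Finset.range c, a (r * g + j) k else 0 := by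
  have h1 : ∀ k, (if k / c < g ∧ r * g + k / c < U then a (r * g + k / c) (k % c) else 0) *
        (if k / c = j then (1 : ℤ) else 0) =
      if k / c = j then (if j < g ∧ r * g + j < U then a (r * g + j) (k % c) else 0) else 0 := by
    intro k
    by_cases h : k / c = j
    · simp only [h, if_true, mul_one]
    · simp only [h, if_false, mul_zero]
  simp only [h1]
  by_cases hv : j < g ∧ r * g + j < U
  swap
  · simp [hv]
  simp only [hv, and_self, if_true]
  rw [← Finset.sum_filter]
  have hc : 0 < c := by
    rcases Nat.eq_zero_or_pos c with h | h
    · rw [h, Nat.div_zero] at hg; omega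
    · exact h
  have hjs : (j + 1) * c ≤ s := (Nat.le_div_iff_mul_le hc).1 (by omega)
  rw [Nat.add_mul, Nat.one_mul] at hjs
  refine Finset.sum_nbij' (fun k => k % c) (fun k => k + j * c) ?_ ?_ ?_ ?_ ?_
  · exact fun k _ => Finset.mem_range.2 (Nat.mod_lt _ hc)
  · intro k hk
    have hk' := Finset.mem_range.1 hk
    refine Finset.mem_filter.2 ⟨Finset.mem_range.2 (by omega), ?_⟩
    rw [Nat.add_mul_div_right _ _ hc, Nat.div_eq_of_lt hk', Nat.zero_add]
  · intro k hk
    rw [← (Finset.mem_filter.1 hk).2]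
    exact Nat.mod_add_div' k c
  · intro k hk
    rw [Nat.add_mul_mod_self_right, Nat.mod_eq_of_lt (Finset.mem_range.1 hk)]
  · exact fun _ _ => rfl

theorem exec_scalar {m : Machine} (op : ScalarOp) (d a b : ℕ) {ρ : ℕ → ℕ}
    {μ : ℕ → BitVec m.width} (v : ℕ) (hv : op.apply (ρ a) (ρ b) = v) (hm : v ≤ m.maxScalar) :
    Exec m (.scalar op d a b) ⟨ρ, μ⟩ ⟨Function.update ρ d v, μ⟩ 1 1 := by
  subst hv
  exact Exec.scalar op d a b ⟨ρ, μ⟩ hm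

theorem exec_const {m : Machine} (d k : ℕ) {ρ : ℕ → ℕ} {μ : ℕ → BitVec m.width}
    (hm : k ≤ m.maxScalar) :
    Exec m (.const d k) ⟨ρ, μ⟩ ⟨Function.update ρ d k, μ⟩ 1 1 :=
  Exec.const d k ⟨ρ, μ⟩ hm

/-- Add up the groups of `reg 8` words each, of which `reg 9` are stored in each row of the matrix
at address `reg 14`; the number of groups is `reg 10`. The matrix at address `reg 13` is used. -/
noncomputable def roundProg : Prog :=
  .seq (.scalar .add 11 10 9) <| .seq (.scalar .sub 11 11 4) <| .seq (.scalar .div 11 11 9) <|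
  .seq (.vec blockInstr 3 8 3 3 13) <| .seq (.matmul 14 11 13 14) <|
  .seq (.scalar .mul 16 10 2) (.vec compactInstr 14 16 3 8 14)

/-- The product overwrites the left factor, and the sums, which are the first g entries of each row,
are then moved together. The right factor ends before D, so writing it leaves the data intact. -/
theorem exec_round {m : Machine} (hB : 2 ≤ m.width) (hs : 0 < m.s) {ρ : ℕ → ℕ}
    {μ : ℕ → BitVec m.width} {c g U A D : ℕ} (h2 : ρ 2 = m.s) (h4 : ρ 4 = 1) (h8 : ρ 8 = c)
    (h9 : ρ 9 = g) (h10 : ρ 10 = U) (h13 : ρ 13 = A) (h14 : ρ 14 = D) (hA : A + m.s * m.s ≤ D)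
    (hc : 0 < c) (hcs : c ≤ m.s) (hg : g = m.s / c) (hmax₁ : U + g ≤ m.maxScalar)
    (hmax₂ : U * m.s ≤ m.maxScalar) (a : ℕ → ℕ → ℤ)
    (hdata : ∀ r < (U + g - 1) / g, ∀ k < m.s, (μ (D + (r * m.s + k))).toInt =
      if k / c < g ∧ r * g + k / c < U then a (r * g + k / c) (k % c) else 0)
    (hfit : ∀ u < U, Fits m.width (∑ k ∈ Finset.range c, a u k)) :
    ∃ (ρ' : ℕ → ℕ) (μ' : ℕ → BitVec m.width) (w : ℕ), w ≤ 2 * (U * m.width) ∧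
      Exec m roundProg ⟨ρ, μ⟩ ⟨ρ', μ'⟩ 7 (m.mmWork ((U + g - 1) / g) + w + 4) ∧
      (∀ r, r ≠ 11 → r ≠ 16 → ρ' r = ρ r) ∧
      ∀ u < U, (μ' (D + u)).toInt = ∑ k ∈ Finset.range c, a u k := by
  have hg0 : 0 < g := hg ▸ Nat.div_pos hcs hc
  have hgs : g ≤ m.s := hg ▸ Nat.div_le_self _ _
  set R := (U + g - 1) / g with hR
  have hRle : R ≤ U + g := (Nat.div_le_self _ _).trans (Nat.sub_le _ _)
  let ρ₁ := Function.update ρ 11 (U + g)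
  let ρ₂ := Function.update ρ₁ 11 (U + g - 1)
  let ρ₃ := Function.update ρ₂ 11 R
  have e1 : Exec m (.scalar .add 11 10 9) ⟨ρ, μ⟩ ⟨ρ₁, μ⟩ 1 1 :=
    exec_scalar _ _ _ _ _ (by simp [ScalarOp.apply, h10, h9]) hmax₁
  have e2 : Exec m (.scalar .sub 11 11 4) ⟨ρ₁, μ⟩ ⟨ρ₂, μ⟩ 1 1 :=
    exec_scalar _ _ _ _ _ (by simp [ScalarOp.apply, ρ₁, h4]) (by omega)
  have e3 : Exec m (.scalar .div 11 11 9) ⟨ρ₂, μ⟩ ⟨ρ₃, μ⟩ 1 1 :=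
    exec_scalar _ _ _ _ _ (by simp [ScalarOp.apply, ρ₂, ρ₁, h9, hR]) (by omega)
  have r2 : ρ₃ 2 = m.s := by simp [ρ₃, ρ₂, ρ₁, h2]
  have r8 : ρ₃ 8 = c := by simp [ρ₃, ρ₂, ρ₁, h8]
  have r10 : ρ₃ 10 = U := by simp [ρ₃, ρ₂, ρ₁, h10]
  have r11 : ρ₃ 11 = R := by simp [ρ₃]
  have r13 : ρ₃ 13 = A := by simp [ρ₃, ρ₂, ρ₁, h13]
  have r14 : ρ₃ 14 = D := by simp [ρ₃, ρ₂, ρ₁, h14]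
  have e4 := exec_block m hB 3 8 3 3 13 ⟨ρ₃, μ⟩
  simp only [State.write, r8, r13] at e4
  set μ₁ : ℕ → BitVec m.width := fun a => if A ≤ a ∧ a < A + m.s * m.s then
    if (a - A) / m.s / c = (a - A) % m.s then 1 else 0 else μ a with hμ₁
  have hdata₁ : ∀ r < R, ∀ k < m.s, (μ₁ (D + (r * m.s + k))).toInt =
      if k / c < g ∧ r * g + k / c < U then a (r * g + k / c) (k % c) else 0 := by
    intro r hr k hk
    rw [← hdata r hr k hk]
    simp only [hμ₁]
    rw [if_neg (by omega)]
  have hmat : ∀ k < m.s, ∀ j < m.s, (μ₁ (A + (k * m.s + j))).toInt =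
      if k / c = j then 1 else 0 := by
    intro k hk j hj
    have hlt : k * m.s + j < m.s * m.s := by
      have := Nat.mul_le_mul_right m.s (Nat.succ_le_of_lt hk)
      rw [Nat.succ_mul] at this
      omega
    simp only [hμ₁]
    rw [if_pos (by omega), Nat.add_sub_cancel_left, Nat.add_comm (k * m.s),
      Nat.add_mul_div_right _ _ hs, Nat.div_eq_of_lt hj, Nat.zero_add, Nat.add_mul_mod_self_right,
      Nat.mod_eq_of_lt hj]
    split_ifs
    · exact BitVec.toInt_one hB
    · exact BitVec.toInt_zero
  have hentry : ∀ r < R, ∀ j < m.s, State.matEntry ⟨ρ₃, μ₁⟩ m.s D A r j =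
      if j < g ∧ r * g + j < U then ∑ k ∈ Finset.range c, a (r * g + j) k else 0 := by
    intro r hr j hj
    rw [← sum_block hg a, State.matEntry]
    refine Finset.sum_congr rfl fun k hk => ?_
    have hk' := Finset.mem_range.1 hk
    rw [hdata₁ r hr k hk', hmat k hk' j hj]
  -- Overflow must be excluded for all s columns, also for those that are dropped afterwards; these
  -- are zero.
  have hfit' : ∀ r < R, ∀ j < m.s, Fits m.width (State.matEntry ⟨ρ₃, μ₁⟩ m.s D A r j) := by
    intro r hr j hj
    rw [hentry r hr j hj]
    split_ifs with h
    · exact hfit _ h.2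
    · exact ⟨by simp, by positivity⟩
  have e5 := Exec.matmul (m := m) 14 11 13 14 ⟨ρ₃, μ₁⟩ (by
    simp only [r11, r13, r14]; exact hfit')
  simp only [State.write, r11, r13, r14] at e5
  set μ₂ : ℕ → BitVec m.width := fun a => if D ≤ a ∧ a < D + R * m.s then
    BitVec.ofInt m.width (State.matEntry ⟨ρ₃, μ₁⟩ m.s D A ((a - D) / m.s) ((a - D) % m.s))
    else μ₁ a with hμ₂
  let ρ₄ := Function.update ρ₃ 16 (U * m.s)
  have e6 : Exec m (.scalar .mul 16 10 2) ⟨ρ₃, μ₂⟩ ⟨ρ₄, μ₂⟩ 1 1 :=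
    exec_scalar _ _ _ _ _ (by simp [ScalarOp.apply, r10, r2]) hmax₂
  have s8 : ρ₄ 8 = c := by simp [ρ₄, r8]
  have s14 : ρ₄ 14 = D := by simp [ρ₄, r14]
  have s16 : ρ₄ 16 = U * m.s := by simp [ρ₄]
  obtain ⟨w, hw, e7⟩ := exec_compact m 14 16 3 8 14 ⟨ρ₄, μ₂⟩ hs s16
    (by simp only [s8, ← hg]; exact hg0)
  simp only [State.write, s8, s14, ← hg] at e7
  have e := e1.seq (e2.seq (e3.seq (e4.seq (e5.seq (e6.seq e7)))))
  have hwork : 1 + (1 + (1 + (0 + (m.mmWork R + (1 + (w : ℝ≥0)))))) = m.mmWork R + w + 4 := by ring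
  rw [hwork] at e
  refine ⟨_, _, w, hw, e, ?_, ?_⟩
  · intro r hr1 hr2
    simp [ρ₄, ρ₃, ρ₂, ρ₁, Function.update_of_ne hr1, Function.update_of_ne hr2]
  · intro u hu
    have hmod : u % g < g := Nat.mod_lt _ hg0
    have hdm := Nat.div_add_mod' u g
    have hr : u / g < R := by
      rw [hR, Nat.lt_div_iff_mul_lt hg0]
      omega
    have hrs := Nat.mul_le_mul_right m.s (Nat.succ_le_of_lt hr)
    rw [Nat.succ_mul] at hrs
    rw [if_pos (by omega), Nat.add_sub_cancel_left]
    simp only [hμ₂]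
    rw [if_pos (by omega), Nat.add_sub_cancel_left, Nat.add_comm (u / g * m.s),
      Nat.add_mul_div_right _ _ hs, Nat.div_eq_of_lt (by omega), Nat.zero_add,
      Nat.add_mul_mod_self_right, Nat.mod_eq_of_lt (a := u % g) (by omega),
      toInt_ofInt_of_fits (hfit' _ hr _ (by omega)) (by omega), hentry _ hr _ (by omega), hdm,
      if_pos ⟨hmod, hu⟩]

/-! ## The multiplication program -/

theorem sum_range_mul_eq {α : Type*} [AddCommMonoid α] (f : ℕ → α) (Q s : ℕ) :
    ∑ p ∈ Finset.range (Q * s), f p =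
      ∑ p ∈ Finset.range Q, ∑ k ∈ Finset.range s, f (p * s + k) := by
  induction Q with
  | zero => simp
  | succ Q ih => rw [Nat.succ_mul, Finset.sum_range_add, ih, Finset.sum_range_succ]

theorem sum_abs_blocks_le (f : ℕ → ℤ) (Q s : ℕ) :
    ∑ p ∈ Finset.range Q, |∑ k ∈ Finset.range s, f (p * s + k)| ≤
      ∑ p ∈ Finset.range (Q * s), |f p| := by
  rw [sum_range_mul_eq]
  exact Finset.sum_le_sum fun p _ => Finset.abs_sum_le_sum_abs _ _

theorem abs_block_le (f : ℕ → ℤ) {Q s p : ℕ} (hp : p < Q) :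
    |∑ k ∈ Finset.range s, f (p * s + k)| ≤ ∑ p ∈ Finset.range (Q * s), |f p| :=
  (Finset.single_le_sum (f := fun p => |∑ k ∈ Finset.range s, f (p * s + k)|)
    (fun _ _ => abs_nonneg _) (Finset.mem_range.2 hp)).trans (sum_abs_blocks_le f Q s)

/-- Compute in `reg 5` the largest power of `reg 2` which is less than `reg 7`. -/
def powerProg : Prog :=
  .whileLt 6 7 (.seq (.scalar .add 5 6 3) (.scalar .mul 6 6 2))

/-- Here i passes of the loop are done and d remain. Register 7 contains B + 1, which turns the
strict loop test into s^(i+1) ≤ B. A pass takes three steps, the test included. -/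
theorem exec_power {m : Machine} (hs : 2 ≤ m.s) {B e : ℕ} (h₁ : m.s ^ e ≤ B)
    (h₂ : B < m.s ^ (e + 1)) (hmax : m.s ^ (e + 1) ≤ m.maxScalar) {μ : ℕ → BitVec m.width} (d : ℕ) :
    ∀ (i : ℕ) (ρ : ℕ → ℕ), i + d = e → ρ 2 = m.s → ρ 3 = 0 → ρ 5 = m.s ^ i →
      ρ 6 = m.s ^ (i + 1) → ρ 7 = B + 1 →
      ∃ ρ' : ℕ → ℕ, Exec m powerProg ⟨ρ, μ⟩ ⟨ρ', μ⟩ (3 * d + 1) ((3 * d + 1 : ℕ) : ℝ≥0) ∧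
        ρ' 5 = m.s ^ e ∧ ∀ r, r ≠ 5 → r ≠ 6 → ρ' r = ρ r := by
  induction d with
  | zero =>
    intro i ρ hi _ _ h5 h6 h7
    rw [Nat.add_zero] at hi
    subst hi
    refine ⟨ρ, ?_, h5, fun _ _ _ => rfl⟩
    have := Exec.while_false (m := m) (a := 6) (b := 7)
      (P := .seq (.scalar .add 5 6 3) (.scalar .mul 6 6 2)) (σ := ⟨ρ, μ⟩)
      (by simp only [h6, h7]; omega)
    simpa [powerProg] using this
  | succ d ih =>
    intro i ρ hi r2 r3 r5 r6 r7
    have hp1 : m.s ^ (i + 1) ≤ m.s ^ e := Nat.pow_le_pow_right (by omega) (by omega)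
    have hp2 : m.s ^ (i + 2) ≤ m.s ^ (e + 1) := Nat.pow_le_pow_right (by omega) (by omega)
    let ρ₁ := Function.update ρ 5 (m.s ^ (i + 1))
    let ρ₂ := Function.update ρ₁ 6 (m.s ^ (i + 2))
    have e1 : Exec m (.scalar .add 5 6 3) ⟨ρ, μ⟩ ⟨ρ₁, μ⟩ 1 1 :=
      exec_scalar _ _ _ _ _ (by simp [ScalarOp.apply, r6, r3]) (by omega)
    have e2 : Exec m (.scalar .mul 6 6 2) ⟨ρ₁, μ⟩ ⟨ρ₂, μ⟩ 1 1 :=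
      exec_scalar _ _ _ _ _ (by simp [ScalarOp.apply, ρ₁, r6, r2, pow_succ]) (by omega)
    obtain ⟨ρ', e3, h5, hr⟩ := ih (i + 1) ρ₂ (by omega) (by simp [ρ₂, ρ₁, r2])
      (by simp [ρ₂, ρ₁, r3]) (by simp [ρ₂, ρ₁]) (by simp [ρ₂]) (by simp [ρ₂, ρ₁, r7])
    refine ⟨ρ', ?_, h5, fun r hr5 hr6 => ?_⟩
    · have := Exec.while_true (m := m) (a := 6) (b := 7) (σ := ⟨ρ, μ⟩)
        (by simp only [r6, r7]; omega) (e1.seq e2) e3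
      have ht : 1 + (1 + 1) + (3 * d + 1) = 3 * (d + 1) + 1 := by ring
      have hw : 1 + (1 + 1) + ((3 * d + 1 : ℕ) : ℝ≥0) = ((3 * (d + 1) + 1 : ℕ) : ℝ≥0) := by
        push_cast; ring
      rw [ht, hw] at this
      exact this
    · rw [hr r hr5 hr6]
      simp [ρ₂, ρ₁, Function.update_of_ne hr5, Function.update_of_ne hr6]

/-- Add up groups of `reg 2` consecutive words until `reg 0` words are left. -/
noncomputable def sumProg : Prog :=
  .whileLt 0 10 (.seq (.scalar .add 8 2 3) (.seq (.const 9 1) (.seq (.scalar .div 10 10 2)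
    roundProg)))

/-- Induction on the number t of remaining rounds. A round replaces `f i` by its sums over s
consecutive indices. This preserves the total `z i` and, by the triangle inequality, the bound b on
the sum of absolute values, which excludes overflow. A round takes 11 steps: the loop test, three
scalar instructions and seven steps of `roundProg`. -/
theorem exec_sum {m : Machine} (hB : 2 ≤ m.width) (hs : 2 ≤ m.s) {n A D : ℕ} (hn : 0 < n)
    (hA : A + m.s * m.s ≤ D) {b : ℤ} (hb : b < 2 ^ (m.width - 1)) (z : ℕ → ℤ) (t : ℕ) :
    ∀ (ρ : ℕ → ℕ) (μ : ℕ → BitVec m.width) (f : ℕ → ℕ → ℤ), n * m.s ^ t + m.s ≤ m.maxScalar →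
      ρ 0 = n → ρ 2 = m.s → ρ 3 = 0 → ρ 4 = 1 → ρ 10 = n * m.s ^ t → ρ 13 = A → ρ 14 = D →
      (∀ u < n * m.s ^ t, (μ (D + u)).toInt = f (u / m.s ^ t) (u % m.s ^ t)) →
      (∀ i < n, ∑ p ∈ Finset.range (m.s ^ t), f i p = z i) →
      (∀ i < n, ∑ p ∈ Finset.range (m.s ^ t), |f i p| ≤ b) →
      ∃ (ρ' : ℕ → ℕ) (μ' : ℕ → BitVec m.width) (w : ℝ≥0),
        Exec m sumProg ⟨ρ, μ⟩ ⟨ρ', μ'⟩ (11 * t + 1) w ∧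
        w ≤ m.mmWork (n * ∑ i ∈ Finset.range t, m.s ^ i) +
          ((2 * m.width * (n * ∑ i ∈ Finset.range t, m.s ^ i) + 8 * t + 1 : ℕ) : ℝ≥0) ∧
        (∀ r, r ≠ 8 → r ≠ 9 → r ≠ 10 → r ≠ 11 → r ≠ 16 → ρ' r = ρ r) ∧
        ∀ i < n, (μ' (D + i)).toInt = z i := by
  induction t with
  | zero =>
    intro ρ μ f _ r0 r2 r3 r4 r10 r13 r14 hμ hz _
    refine ⟨ρ, μ, 1, ?_, by simp, fun _ _ _ _ _ _ => rfl, fun i hi => ?_⟩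
    · exact Exec.while_false (by simp [r0, r10])
    · rw [hμ i (by simpa using hi), ← hz i hi]
      simp [Nat.mod_one]
  | succ t ih =>
    intro ρ μ f hmax r0 r2 r3 r4 r10 r13 r14 hμ hz habs
    set Q := m.s ^ t with hQ
    have hs0 : 0 < m.s := by omega
    have hQ0 : 0 < Q := pow_pos hs0 t
    have hQs : m.s ^ (t + 1) = Q * m.s := pow_succ _ _
    rw [hQs] at hmax r10 hμ hz habs
    set U := n * Q with hU
    have hU0 : 0 < U := Nat.mul_pos hn hQ0
    have hUs : n * (Q * m.s) = U * m.s := by rw [hU]; ring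
    rw [hUs] at hmax r10 hμ
    have hUle : U ≤ U * m.s := Nat.le_mul_of_pos_right _ hs0
    -- The loop is entered exactly while more than n words are left; this uses s ≥ 2 and n > 0.
    have hnU : n < U * m.s := by
      have h1 : n ≤ U := Nat.le_mul_of_pos_right _ hQ0
      have h2 := Nat.mul_le_mul_left U hs
      omega
    let ρ₁ := Function.update ρ 8 m.s
    let ρ₂ := Function.update ρ₁ 9 1
    let ρ₃ := Function.update ρ₂ 10 U
    have e1 : Exec m (.scalar .add 8 2 3) ⟨ρ, μ⟩ ⟨ρ₁, μ⟩ 1 1 :=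
      exec_scalar _ _ _ _ _ (by simp [ScalarOp.apply, r2, r3]) (by omega)
    have e2 : Exec m (.const 9 1) ⟨ρ₁, μ⟩ ⟨ρ₂, μ⟩ 1 1 := exec_const _ _ (by omega)
    have e3 : Exec m (.scalar .div 10 10 2) ⟨ρ₂, μ⟩ ⟨ρ₃, μ⟩ 1 1 :=
      exec_scalar _ _ _ _ _
        (by simp [ScalarOp.apply, ρ₂, ρ₁, r10, r2, Nat.mul_div_cancel _ hs0]) (by omega)
    have hblock : ∀ u < U, ∀ k < m.s, u * m.s + k < U * m.s ∧
        (u * m.s + k) / (Q * m.s) = u / Q ∧ (u * m.s + k) % (Q * m.s) = u % Q * m.s + k := by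
      intro u hu k hk
      have h1 := Nat.mul_le_mul_right m.s (Nat.succ_le_of_lt hu)
      rw [Nat.succ_mul] at h1
      have h2 : (u * m.s + k) / m.s = u := by
        rw [Nat.add_comm, Nat.add_mul_div_right _ _ hs0, Nat.div_eq_of_lt hk, Nat.zero_add]
      have h3 : (u * m.s + k) % m.s = k := by
        rw [Nat.add_comm, Nat.add_mul_mod_self_right, Nat.mod_eq_of_lt hk]
      refine ⟨by omega, ?_, ?_⟩
      · rw [Nat.mul_comm Q, ← Nat.div_div_eq_div_mul, h2]
      · rw [Nat.mul_comm Q, Nat.mod_mul, h2, h3]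
        ring
    have hdiv : ∀ u < U, u / Q < n := fun u hu =>
      Nat.div_lt_of_lt_mul (by rw [Nat.mul_comm]; exact hu)
    -- With c = s and g = 1 a group is a whole row, so the words already form the left factor and no
    -- rearrangement is needed.
    obtain ⟨ρ₄, μ₄, w, hw, e4, hr4, hμ4⟩ := exec_round (μ := μ) (ρ := ρ₃) (c := m.s) (g := 1)
      (U := U) hB hs0 (by simp [ρ₃, ρ₂, ρ₁, r2]) (by simp [ρ₃, ρ₂, ρ₁, r4])
      (by simp [ρ₃, ρ₂, ρ₁]) (by simp [ρ₃, ρ₂]) (by simp [ρ₃])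
      (by simpa [ρ₃, ρ₂, ρ₁] using r13) (by simpa [ρ₃, ρ₂, ρ₁] using r14) hA hs0 le_rfl
      (Nat.div_self hs0).symm (by omega) (by omega)
      (fun u k => f (u / Q) (u % Q * m.s + k)) (by
        intro r hr k hk
        have hr' : r < U := by simpa using hr
        obtain ⟨h1, h2, h3⟩ := hblock r hr' k hk
        rw [hμ _ h1, h2, h3, Nat.div_eq_of_lt hk, Nat.mod_eq_of_lt hk]
        simp [hr'])
      (fun u hu => fits_of_abs_le ((abs_block_le (f (u / Q)) (Nat.mod_lt u hQ0)).trans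
        (habs _ (hdiv u hu))) hb)
    have hR : (U + 1 - 1) / 1 = U := by simp
    rw [hR] at e4
    have hle : U + m.s ≤ m.maxScalar := by omega
    obtain ⟨ρ', μ', w', e5, hw', hr', hz'⟩ := ih ρ₄ μ₄
      (fun i p => ∑ k ∈ Finset.range m.s, f i (p * m.s + k)) hle
      (by rw [hr4 _ (by decide) (by decide)]; simp [ρ₃, ρ₂, ρ₁, r0])
      (by rw [hr4 _ (by decide) (by decide)]; simp [ρ₃, ρ₂, ρ₁, r2])
      (by rw [hr4 _ (by decide) (by decide)]; simp [ρ₃, ρ₂, ρ₁, r3])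
      (by rw [hr4 _ (by decide) (by decide)]; simp [ρ₃, ρ₂, ρ₁, r4])
      (by rw [hr4 _ (by decide) (by decide)]; simp [ρ₃])
      (by rw [hr4 _ (by decide) (by decide)]; simp [ρ₃, ρ₂, ρ₁, r13])
      (by rw [hr4 _ (by decide) (by decide)]; simp [ρ₃, ρ₂, ρ₁, r14])
      hμ4
      (fun i hi => by rw [← hz i hi, sum_range_mul_eq])
      (fun i hi => (sum_abs_blocks_le (f i) _ _).trans (habs i hi))
    have e := Exec.while_true (m := m) (a := 0) (b := 10) (σ := ⟨ρ, μ⟩)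
      (by simp only [r0, r10]; exact hnU) (e1.seq (e2.seq (e3.seq e4))) e5
    have ht : 1 + (1 + (1 + (1 + 7))) + (11 * t + 1) = 11 * (t + 1) + 1 := by ring
    rw [ht] at e
    refine ⟨ρ', μ', _, e, ?_, ?_, hz'⟩
    · rw [Finset.sum_range_succ, ← hQ, Nat.mul_add, map_add, ← hU]
      have hw2 : (w : ℝ≥0) ≤ ((2 * (U * m.width) : ℕ) : ℝ≥0) := Nat.cast_le.2 hw
      calc 1 + (1 + (1 + (1 + (m.mmWork U + w + 4)))) + w'
          ≤ 1 + (1 + (1 + (1 + (m.mmWork U + ((2 * (U * m.width) : ℕ) : ℝ≥0) + 4)))) +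
            (m.mmWork (n * ∑ i ∈ Finset.range t, m.s ^ i) +
            ((2 * m.width * (n * ∑ i ∈ Finset.range t, m.s ^ i) + 8 * t + 1 : ℕ) : ℝ≥0)) := by
            gcongr
        _ = _ := by push_cast; ring
    · intro r h8 h9 h10 h11 h16
      rw [hr' r h8 h9 h10 h11 h16, hr4 r h11 h16]
      simp [ρ₃, ρ₂, ρ₁, Function.update_of_ne h8, Function.update_of_ne h9,
        Function.update_of_ne h10]

/-- Compute lengths and addresses: the number of groups per component (`reg 5`), the size of a
group (`reg 8`), the number of groups per row (`reg 9`), the number of groups (`reg 10`), the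
addresses of the output (`reg 12`), of the right factor (`reg 13`) and of the left factor
(`reg 14`). -/
def setupProg : Prog :=
  .seq (.const 4 1) <| .seq (.const 5 1) <| .seq (.scalar .add 6 2 3) <|
  .seq (.scalar .add 7 1 4) <| .seq powerProg <| .seq (.scalar .add 8 1 5) <|
  .seq (.scalar .sub 8 8 4) <| .seq (.scalar .div 8 8 5) <| .seq (.scalar .div 9 2 8) <|
  .seq (.scalar .mul 10 0 5) <| .seq (.scalar .add 12 0 0) <| .seq (.scalar .add 13 12 0) <|
  .seq (.scalar .mul 14 2 2) (.scalar .add 14 14 13)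

theorem exec_setup {m : Machine} {n e : ℕ} (hs : 2 ≤ m.s) (hn : 1 ≤ n) (hB : 6 ≤ m.width)
    (h₁ : m.s ^ e ≤ m.width) (h₂ : m.width < m.s ^ (e + 1))
    (hmax : (n * m.s * m.width) ^ 2 ≤ m.maxScalar) {ρ : ℕ → ℕ} {μ : ℕ → BitVec m.width}
    (r0 : ρ 0 = n) (r1 : ρ 1 = m.width) (r2 : ρ 2 = m.s) (r3 : ρ 3 = 0) :
    ∃ ρ' : ℕ → ℕ, Exec m setupProg ⟨ρ, μ⟩ ⟨ρ', μ⟩ (3 * e + 14) ((3 * e + 14 : ℕ) : ℝ≥0) ∧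
      ρ' 0 = n ∧ ρ' 2 = m.s ∧ ρ' 3 = 0 ∧ ρ' 4 = 1 ∧ ρ' 5 = m.s ^ e ∧
      ρ' 8 = (m.width + m.s ^ e - 1) / m.s ^ e ∧
      ρ' 9 = m.s / ((m.width + m.s ^ e - 1) / m.s ^ e) ∧ ρ' 10 = n * m.s ^ e ∧
      ρ' 12 = 2 * n ∧ ρ' 13 = 3 * n ∧ ρ' 14 = 3 * n + m.s * m.s := by
  set P := m.s ^ e with hP
  set c := (m.width + P - 1) / P with hc
  -- Estimates of all scalar values in terms of N = nsB. The square of N is needed for s·s, the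
  -- length of the right factor, which may exceed N.
  have b0 : n ≤ n * (m.s * m.width) := Nat.le_mul_of_pos_right _ (by positivity)
  have b1 : 6 * (n * m.s) ≤ n * m.s * m.width := by rw [Nat.mul_comm]; exact Nat.mul_le_mul_left _ hB
  have b2 : 2 * m.width ≤ n * m.s * m.width := Nat.mul_le_mul_right _ (by nlinarith)
  have b3 : m.s * m.width ≤ n * m.s * m.width := Nat.mul_le_mul_right _ (Nat.le_mul_of_pos_left _ hn)
  have b4 : n * m.width ≤ n * m.s * m.width :=
    Nat.mul_le_mul_right _ (Nat.le_mul_of_pos_right _ (by omega))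
  have b5 : n * P ≤ n * m.width := Nat.mul_le_mul_left _ h₁
  have b6 : m.s ≤ n * m.s := Nat.le_mul_of_pos_left _ hn
  have b7 : n ≤ n * m.s := Nat.le_mul_of_pos_right _ (by omega)
  have b8 : m.s ^ (e + 1) ≤ m.s * m.width := by
    rw [pow_succ, Nat.mul_comm]
    exact Nat.mul_le_mul_left _ h₁
  have b9 : m.s * m.s ≤ (n * m.s) * (n * m.s) := Nat.mul_le_mul b6 b6
  set N := n * m.s * m.width with hN
  have b10 : 6 * (n * m.s) * (6 * (n * m.s)) ≤ N * N := Nat.mul_le_mul b1 b1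
  have b11 : n * m.s ≤ n * m.s * (n * m.s) := Nat.le_mul_of_pos_left _ (by omega)
  have b12 : N ≤ N ^ 2 := Nat.le_self_pow (by norm_num) _
  have b13 : N * N = N ^ 2 := (pow_two N).symm
  have b14 : 6 * (n * m.s) * (6 * (n * m.s)) = 36 * (n * m.s * (n * m.s)) := by ring
  have bc : c ≤ m.width + P - 1 := Nat.div_le_self _ _
  have bg : m.s / c ≤ m.s := Nat.div_le_self _ _
  let ρ₁ := Function.update ρ 4 1
  let ρ₂ := Function.update ρ₁ 5 1
  let ρ₃ := Function.update ρ₂ 6 m.s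
  let ρ₄ := Function.update ρ₃ 7 (m.width + 1)
  have e1 : Exec m (.const 4 1) ⟨ρ, μ⟩ ⟨ρ₁, μ⟩ 1 1 := exec_const _ _ (by omega)
  have e2 : Exec m (.const 5 1) ⟨ρ₁, μ⟩ ⟨ρ₂, μ⟩ 1 1 := exec_const _ _ (by omega)
  have e3 : Exec m (.scalar .add 6 2 3) ⟨ρ₂, μ⟩ ⟨ρ₃, μ⟩ 1 1 :=
    exec_scalar _ _ _ _ _ (by simp [ScalarOp.apply, ρ₂, ρ₁, r2, r3]) (by omega)
  have e4 : Exec m (.scalar .add 7 1 4) ⟨ρ₃, μ⟩ ⟨ρ₄, μ⟩ 1 1 :=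
    exec_scalar _ _ _ _ _ (by simp [ScalarOp.apply, ρ₃, ρ₂, ρ₁, r1]) (by omega)
  obtain ⟨ρ₅, e5, p5, hr⟩ := exec_power (μ := μ) hs h₁ h₂
    (b8.trans (b3.trans (b12.trans hmax))) e 0 ρ₄ (by omega)
    (by simp [ρ₄, ρ₃, ρ₂, ρ₁, r2]) (by simp [ρ₄, ρ₃, ρ₂, ρ₁, r3]) (by simp [ρ₄, ρ₃, ρ₂])
    (by simp [ρ₄, ρ₃]) (by simp [ρ₄])
  have p0 : ρ₅ 0 = n := by rw [hr _ (by decide) (by decide)]; simp [ρ₄, ρ₃, ρ₂, ρ₁, r0]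
  have p1 : ρ₅ 1 = m.width := by rw [hr _ (by decide) (by decide)]; simp [ρ₄, ρ₃, ρ₂, ρ₁, r1]
  have p2 : ρ₅ 2 = m.s := by rw [hr _ (by decide) (by decide)]; simp [ρ₄, ρ₃, ρ₂, ρ₁, r2]
  have p3 : ρ₅ 3 = 0 := by rw [hr _ (by decide) (by decide)]; simp [ρ₄, ρ₃, ρ₂, ρ₁, r3]
  have p4 : ρ₅ 4 = 1 := by rw [hr _ (by decide) (by decide)]; simp [ρ₄, ρ₃, ρ₂, ρ₁]
  change ρ₅ 5 = P at p5
  let ρ₆ := Function.update ρ₅ 8 (m.width + P)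
  let ρ₇ := Function.update ρ₆ 8 (m.width + P - 1)
  let ρ₈ := Function.update ρ₇ 8 c
  let ρ₉ := Function.update ρ₈ 9 (m.s / c)
  let ρ₁₀ := Function.update ρ₉ 10 (n * P)
  let ρ₁₁ := Function.update ρ₁₀ 12 (2 * n)
  let ρ₁₂ := Function.update ρ₁₁ 13 (3 * n)
  let ρ₁₃ := Function.update ρ₁₂ 14 (m.s * m.s)
  let ρ₁₄ := Function.update ρ₁₃ 14 (3 * n + m.s * m.s)
  have e6 : Exec m (.scalar .add 8 1 5) ⟨ρ₅, μ⟩ ⟨ρ₆, μ⟩ 1 1 :=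
    exec_scalar _ _ _ _ _ (by simp [ScalarOp.apply, p1, p5]) (by omega)
  have e7 : Exec m (.scalar .sub 8 8 4) ⟨ρ₆, μ⟩ ⟨ρ₇, μ⟩ 1 1 :=
    exec_scalar _ _ _ _ _ (by simp [ScalarOp.apply, ρ₆, p4]) (by omega)
  have e8 : Exec m (.scalar .div 8 8 5) ⟨ρ₇, μ⟩ ⟨ρ₈, μ⟩ 1 1 :=
    exec_scalar _ _ _ _ _ (by simp [ScalarOp.apply, ρ₇, ρ₆, p5, hc]) (by omega)
  have e9 : Exec m (.scalar .div 9 2 8) ⟨ρ₈, μ⟩ ⟨ρ₉, μ⟩ 1 1 :=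
    exec_scalar _ _ _ _ _ (by simp [ScalarOp.apply, ρ₈, ρ₇, ρ₆, p2]) (by omega)
  have e10 : Exec m (.scalar .mul 10 0 5) ⟨ρ₉, μ⟩ ⟨ρ₁₀, μ⟩ 1 1 :=
    exec_scalar _ _ _ _ _ (by simp [ScalarOp.apply, ρ₉, ρ₈, ρ₇, ρ₆, p0, p5]) (by omega)
  have e11 : Exec m (.scalar .add 12 0 0) ⟨ρ₁₀, μ⟩ ⟨ρ₁₁, μ⟩ 1 1 :=
    exec_scalar _ _ _ _ _ (by simp [ScalarOp.apply, ρ₁₀, ρ₉, ρ₈, ρ₇, ρ₆, p0]; omega) (by omega)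
  have e12 : Exec m (.scalar .add 13 12 0) ⟨ρ₁₁, μ⟩ ⟨ρ₁₂, μ⟩ 1 1 :=
    exec_scalar _ _ _ _ _ (by simp [ScalarOp.apply, ρ₁₁, ρ₁₀, ρ₉, ρ₈, ρ₇, ρ₆, p0]; omega)
      (by omega)
  have e13 : Exec m (.scalar .mul 14 2 2) ⟨ρ₁₂, μ⟩ ⟨ρ₁₃, μ⟩ 1 1 :=
    exec_scalar _ _ _ _ _ (by simp [ScalarOp.apply, ρ₁₂, ρ₁₁, ρ₁₀, ρ₉, ρ₈, ρ₇, ρ₆, p2])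
      (by omega)
  have e14 : Exec m (.scalar .add 14 14 13) ⟨ρ₁₃, μ⟩ ⟨ρ₁₄, μ⟩ 1 1 :=
    exec_scalar _ _ _ _ _ (by simp [ScalarOp.apply, ρ₁₃, ρ₁₂]; omega) (by omega)
  have ex := e1.seq (e2.seq (e3.seq (e4.seq (e5.seq (e6.seq (e7.seq (e8.seq (e9.seq (e10.seq
    (e11.seq (e12.seq (e13.seq e14))))))))))))
  have ht : 1 + (1 + (1 + (1 + (3 * e + 1 + (1 + (1 + (1 + (1 + (1 + (1 + (1 + (1 + 1)))))))))))) =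
      3 * e + 14 := by ring
  have hw : 1 + (1 + (1 + (1 + (((3 * e + 1 : ℕ) : ℝ≥0) + (1 + (1 + (1 +
      (1 + (1 + (1 + (1 + (1 + 1)))))))))))) = ((3 * e + 14 : ℕ) : ℝ≥0) := by push_cast; ring
  rw [ht, hw] at ex
  refine ⟨ρ₁₄, ex, ?_⟩
  simp [ρ₁₄, ρ₁₃, ρ₁₂, ρ₁₁, ρ₁₀, ρ₉, ρ₈, ρ₇, ρ₆, p0, p2, p3, p4, p5]

/-- Element-wise multiplication of two vectors. -/
noncomputable def multProg : Prog :=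
  .seq setupProg <| .seq (.vec complementInstr 3 0 3 3 12) <|
  .seq (.vec expandInstr 3 13 3 5 14) <| .seq roundProg <| .seq sumProg <|
  .seq (.scalar .mul 16 0 2) (.vec compactInstr 14 16 3 4 12)

/-- The quotient is ⌈B / s^e⌉. A group fits into a row because B < s^e·s, and the groups of a
component have room for B words. -/
theorem groupSize_bounds {s B e : ℕ} (hs : 0 < s) (h₂ : B < s ^ (e + 1)) (hB : 0 < B) :
    0 < (B + s ^ e - 1) / s ^ e ∧ (B + s ^ e - 1) / s ^ e ≤ s ∧
      B ≤ s ^ e * ((B + s ^ e - 1) / s ^ e) := by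
  have hP : 0 < s ^ e := pow_pos hs e
  refine ⟨Nat.div_pos (by omega) hP, ?_, ?_⟩
  · rw [Nat.div_le_iff_le_mul_add_pred hP]
    rw [pow_succ] at h₂
    omega
  · have := Nat.lt_mul_div_succ (B + s ^ e - 1) hP
    rw [Nat.mul_add] at this
    omega

/-- Memory layout: x, y and the complement of x occupy n words each, followed by the s × s right
factor at 3n and the left factor at D = 3n + s². The complement uses the output area, which is free
until the final copy. -/
theorem exec_mult {m : Machine} {n e : ℕ} (hs : 2 ≤ m.s) (hn : 1 ≤ n) (hB : 6 ≤ m.width)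
    (h₁ : m.s ^ e ≤ m.width) (h₂ : m.width < m.s ^ (e + 1))
    (hmax : (n * m.s * m.width) ^ 2 ≤ m.maxScalar) (x y : Fin n → ℤ)
    (hx : ∀ i, |x i| < 2 ^ (m.width / 4)) (hy : ∀ i, |y i| < 2 ^ (m.width / 4)) {P g R : ℕ}
    (hP : P = m.s ^ e) (hg : g = m.s / ((m.width + P - 1) / P)) (hR : R = (n * P + g - 1) / g) :
    ∃ (τ : State m.width) (w : ℝ≥0), Exec m multProg (initState m x y) τ (14 * e + 26) w ∧
      IsOutput τ (fun i => x i * y i) ∧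
      w ≤ m.mmWork R + m.mmWork (n * ∑ i ∈ Finset.range e, m.s ^ i) +
        ((2 * (n * m.width) + 2 * (R * m.s * m.width) + 2 * (n * P * m.width) +
          2 * m.width * (n * ∑ i ∈ Finset.range e, m.s ^ i) + 2 * (n * m.width) +
          11 * e + 20 : ℕ) : ℝ≥0) := by
  have hs0 : 0 < m.s := by omega
  have hB0 : 0 < m.width := by omega
  set h := m.width / 4 with hh
  have hhB : 2 * h + 3 ≤ m.width := by omega
  obtain ⟨ρ, e1, p0, p2, p3, p4, p5, p8, p9, p10, p12, p13, p14⟩ :=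
    exec_setup (μ := (initState m x y).mem) (ρ := (initState m x y).reg) hs hn hB h₁ h₂ hmax
      rfl rfl rfl rfl
  obtain ⟨c0, cs, cB⟩ := groupSize_bounds hs0 h₂ hB0
  rw [← hP] at p5 p8 p9 p10 c0 cs cB h₁
  set c := (m.width + P - 1) / P with hc
  rw [← hg] at p9
  have hP0 : 0 < P := hP ▸ pow_pos hs0 e
  have hg0 : 0 < g := hg ▸ Nat.div_pos cs c0
  have hgs : g ≤ m.s := hg ▸ Nat.div_le_self _ _
  have m1 : n * P ≤ n * m.width := Nat.mul_le_mul_left _ h₁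
  have m2 : n * m.width + m.s ≤ (n * m.s * m.width) ^ 2 := by
    have a1 : n * m.width ≤ n * m.s * m.width :=
      Nat.mul_le_mul_right _ (Nat.le_mul_of_pos_right _ hs0)
    have a2 : m.s ≤ n * m.s * m.width := by
      rw [Nat.mul_comm n, Nat.mul_assoc]
      exact Nat.le_mul_of_pos_right _ (by positivity)
    have a3 : m.width ≤ n * m.width := Nat.le_mul_of_pos_left _ hn
    have a4 := Nat.mul_le_mul_right (n * m.s * m.width) (show 2 ≤ n * m.s * m.width by omega)
    rw [pow_two]
    omega
  have m3 : n * P * m.s ≤ (n * m.s * m.width) ^ 2 := by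
    have a1 : n * P * m.s ≤ n * m.width * m.s := Nat.mul_le_mul_right _ m1
    have a2 : n * m.width * m.s = n * m.s * m.width := by ring
    exact (a1.trans a2.le).trans (Nat.le_self_pow (by norm_num) _)
  have m4 : n * m.s ≤ n * P * m.s :=
    Nat.mul_le_mul_right _ (Nat.le_mul_of_pos_right _ hP0)
  let X : ℕ → ℤ := fun i => if h : i < n then x ⟨i, h⟩ else 0
  let Y : ℕ → ℤ := fun i => if h : i < n then y ⟨i, h⟩ else 0
  have hX : ∀ i < n, |X i| < 2 ^ h := fun i hi => by simpa [X, hi] using hx ⟨i, hi⟩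
  have hY : ∀ i < n, |Y i| < 2 ^ h := fun i hi => by simpa [Y, hi] using hy ⟨i, hi⟩
  obtain ⟨w₂, hw₂, e2⟩ := exec_complement m 3 0 3 3 12 ⟨ρ, (initState m x y).mem⟩
  simp only [State.write, p0, p3, p12, Nat.zero_add] at e2 hw₂
  set μ₁ : ℕ → BitVec m.width := fun a => if 2 * n ≤ a ∧ a < 2 * n + n then
    ~~~(initState m x y).mem (a - 2 * n) else (initState m x y).mem a with hμ₁
  have mx : ∀ i < n, (initState m x y).mem i = BitVec.ofInt m.width (X i) := fun i hi => by
    simp [initState, X, hi]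
  have q1 : ∀ i < n, μ₁ i = BitVec.ofInt m.width (X i) := fun i hi => by
    simp only [hμ₁]
    rw [if_neg (by omega), mx i hi]
  have q2 : ∀ i < n, μ₁ (n + i) = BitVec.ofInt m.width (Y i) := fun i hi => by
    simp only [hμ₁]
    rw [if_neg (by omega)]
    simp [initState, Y, hi]
  have q3 : ∀ i < n, μ₁ (2 * n + i) = ~~~BitVec.ofInt m.width (X i) := fun i hi => by
    simp only [hμ₁]
    rw [if_pos (by omega), Nat.add_sub_cancel_left, mx i hi]
  obtain ⟨w₃, hw₃, e3⟩ := exec_expand m 3 13 3 5 14 ⟨ρ, μ₁⟩ (n := n) rfl p13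
  simp only [State.write, Shape.perRow, Shape.groupSize, Shape.index, Shape.group, p3, p5,
    p14, ← hc, ← hg, ← hR, Nat.zero_add] at e3 hw₃
  set D := 3 * n + m.s * m.s with hD
  set μ₂ : ℕ → BitVec m.width := fun a => if D ≤ a ∧ a < D + R * m.s then
    if (a - D) % m.s / c < g ∧ (a - D) / m.s * g + (a - D) % m.s / c < n * P then
      partialProduct (m.width / 4) (μ₁ (((a - D) / m.s * g + (a - D) % m.s / c) / P))
        (μ₁ (2 * n + ((a - D) / m.s * g + (a - D) % m.s / c) / P))
        (μ₁ (n + ((a - D) / m.s * g + (a - D) % m.s / c) / P))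
        (((a - D) / m.s * g + (a - D) % m.s / c) % P * c + (a - D) % m.s % c)
    else 0 else μ₁ a with hμ₂
  let f : ℕ → ℕ → ℤ := fun i => partialValue h (X i) (Y i)
  have hdiv : ∀ u < n * P, u / P < n := fun u hu =>
    Nat.div_lt_of_lt_mul (by rwa [Nat.mul_comm])
  have hdata : ∀ r < R, ∀ k < m.s, (μ₂ (D + (r * m.s + k))).toInt =
      if k / c < g ∧ r * g + k / c < n * P then
        f ((r * g + k / c) / P) ((r * g + k / c) % P * c + k % c) else 0 := by
    intro r hr k hk
    have hrs := Nat.mul_le_mul_right m.s (Nat.succ_le_of_lt hr)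
    rw [Nat.succ_mul] at hrs
    have d1 : (r * m.s + k) / m.s = r := by
      rw [Nat.add_comm, Nat.add_mul_div_right _ _ hs0, Nat.div_eq_of_lt hk, Nat.zero_add]
    have d2 : (r * m.s + k) % m.s = k := by
      rw [Nat.add_comm, Nat.add_mul_mod_self_right, Nat.mod_eq_of_lt hk]
    simp only [hμ₂]
    rw [if_pos (by omega), Nat.add_sub_cancel_left, d1, d2]
    split_ifs with hv
    · have hi := hdiv _ hv.2
      rw [q1 _ hi, q2 _ hi, q3 _ hi, toInt_partialProduct hhB (hX _ hi)]
    · exact BitVec.toInt_zero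
  -- All h + 2 nonzero partial products have a place, since B ≤ P·c; the remaining places hold
  -- zeros.
  have hlen : h + 2 ≤ P * c := by omega
  have hb : (2 : ℤ) ^ (2 * h + 1) < 2 ^ (m.width - 1) :=
    pow_lt_pow_right₀ (by norm_num) (by omega)
  have habs : ∀ i < n, ∑ j ∈ Finset.range (P * c), |f i j| ≤ 2 ^ (2 * h + 1) := fun i hi =>
    sum_abs_partialValue hlen (hX i hi)
  obtain ⟨ρ₄, μ₄, w₄, hw₄, e4, hr4, hμ4⟩ := exec_round (μ := μ₂) (ρ := ρ) (by omega) hs0 p2 p4 p8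
    p9 p10 p13 p14 le_rfl c0 cs hg (by omega) (m3.trans hmax)
    (fun u k => f (u / P) (u % P * c + k)) (by rw [← hR]; exact hdata)
    (fun u hu => fits_of_abs_le ((abs_block_le (f (u / P)) (Nat.mod_lt u hP0)).trans
      (habs _ (hdiv u hu))) hb)
  rw [← hR] at e4
  obtain ⟨ρ₅, μ₅, w₅, e5, hw₅, hr5, hμ5⟩ := exec_sum (by omega) hs hn (A := 3 * n) (D := D) le_rfl
    hb (fun i => X i * Y i) e ρ₄ μ₄ (fun i p => ∑ k ∈ Finset.range c, f i (p * c + k))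
    (by rw [← hP]; omega)
    ((hr4 _ (by decide) (by decide)).trans p0) ((hr4 _ (by decide) (by decide)).trans p2)
    ((hr4 _ (by decide) (by decide)).trans p3) ((hr4 _ (by decide) (by decide)).trans p4)
    (by rw [← hP]; exact (hr4 _ (by decide) (by decide)).trans p10)
    ((hr4 _ (by decide) (by decide)).trans p13) ((hr4 _ (by decide) (by decide)).trans p14)
    (by rw [← hP]; exact hμ4)
    (fun i hi => by rw [← hP, ← sum_range_mul_eq]; exact sum_partialValue hlen (hY i hi))
    (fun i hi => by rw [← hP]; exact (sum_abs_blocks_le (f i) _ _).trans (habs i hi))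
  have s0 : ρ₅ 0 = n := by
    rw [hr5 _ (by decide) (by decide) (by decide) (by decide) (by decide),
      hr4 _ (by decide) (by decide), p0]
  have s2 : ρ₅ 2 = m.s := by
    rw [hr5 _ (by decide) (by decide) (by decide) (by decide) (by decide),
      hr4 _ (by decide) (by decide), p2]
  have s4 : ρ₅ 4 = 1 := by
    rw [hr5 _ (by decide) (by decide) (by decide) (by decide) (by decide),
      hr4 _ (by decide) (by decide), p4]
  have s12 : ρ₅ 12 = 2 * n := by
    rw [hr5 _ (by decide) (by decide) (by decide) (by decide) (by decide),
      hr4 _ (by decide) (by decide), p12]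
  have s14 : ρ₅ 14 = D := by
    rw [hr5 _ (by decide) (by decide) (by decide) (by decide) (by decide),
      hr4 _ (by decide) (by decide), p14]
  let ρ₆ := Function.update ρ₅ 16 (n * m.s)
  have e6 : Exec m (.scalar .mul 16 0 2) ⟨ρ₅, μ₅⟩ ⟨ρ₆, μ₅⟩ 1 1 :=
    exec_scalar _ _ _ _ _ (by simp [ScalarOp.apply, s0, s2]) (by omega)
  have t4 : ρ₆ 4 = 1 := by simp [ρ₆, s4]
  have t12 : ρ₆ 12 = 2 * n := by simp [ρ₆, s12]
  have t14 : ρ₆ 14 = D := by simp [ρ₆, s14]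
  have t16 : ρ₆ 16 = n * m.s := by simp [ρ₆]
  -- With second operand length 1 all s words of a row are kept, so compaction is a plain copy of n
  -- words to the output area.
  obtain ⟨w₇, hw₇, e7⟩ := exec_compact m 14 16 3 4 12 ⟨ρ₆, μ₅⟩ hs0 t16
    (by simp only [t4, Nat.div_one]; exact hs0)
  simp only [State.write, t4, t12, t14, Nat.div_one, Nat.div_add_mod'] at e7
  have ex := e1.seq (e2.seq (e3.seq (e4.seq (e5.seq (e6.seq e7)))))
  have ht : 3 * e + 14 + (1 + (1 + (7 + (11 * e + 1 + (1 + 1))))) = 14 * e + 26 := by ring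
  rw [ht] at ex
  refine ⟨_, _, ex, fun i => ?_, ?_⟩
  · have hi := i.2
    dsimp only
    rw [if_pos (by omega), Nat.add_sub_cancel_left, hμ5 i hi]
    simp [X, Y]
  · have w2 : (w₂ : ℝ≥0) ≤ ((2 * (n * m.width) : ℕ) : ℝ≥0) := Nat.cast_le.2 hw₂
    have w3 : (w₃ : ℝ≥0) ≤ ((2 * (R * m.s * m.width) : ℕ) : ℝ≥0) := Nat.cast_le.2 hw₃
    have w4 : (w₄ : ℝ≥0) ≤ ((2 * (n * P * m.width) : ℕ) : ℝ≥0) := Nat.cast_le.2 hw₄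
    have w7 : (w₇ : ℝ≥0) ≤ ((2 * (n * m.width) : ℕ) : ℝ≥0) := Nat.cast_le.2 hw₇
    calc _ ≤ ((3 * e + 14 : ℕ) : ℝ≥0) + (((2 * (n * m.width) : ℕ) : ℝ≥0) +
          (((2 * (R * m.s * m.width) : ℕ) : ℝ≥0) +
          ((m.mmWork R + ((2 * (n * P * m.width) : ℕ) : ℝ≥0) + 4) +
          ((m.mmWork (n * ∑ i ∈ Finset.range e, m.s ^ i) +
            ((2 * m.width * (n * ∑ i ∈ Finset.range e, m.s ^ i) + 8 * e + 1 : ℕ) : ℝ≥0)) +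
          (1 + ((2 * (n * m.width) : ℕ) : ℝ≥0)))))) := by gcongr
      _ = _ := by push_cast; ring

/-! ### Bounds for the number of rows and the work -/

/-- Rounding loses only constant factors: s < c(g + 1) ≤ 2gc because g ≥ 1, and Pc ≤ B + P - 1 ≤ 2B
because P ≤ B. -/
theorem mul_rows_le {s B e n P c g R : ℕ} (hs : 0 < s) (hP : P = s ^ e)
    (h₁ : P ≤ B) (h₂ : B < s ^ (e + 1)) (hB : 0 < B) (hc : c = (B + P - 1) / P) (hg : g = s / c)
    (hR : R = (n * P + g - 1) / g) : R * s ≤ 4 * (n * B) + 2 * s := by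
  obtain ⟨c0, cs, -⟩ := groupSize_bounds hs h₂ hB
  rw [← hP, ← hc] at c0 cs
  have hg0 : 0 < g := hg ▸ Nat.div_pos cs c0
  have a1 : R * g ≤ n * P + g := by
    rw [hR]
    exact (Nat.div_mul_le_self _ _).trans (Nat.sub_le _ _)
  have a2 : s ≤ 2 * (g * c) := by
    have b1 : s < c * (s / c + 1) := Nat.lt_mul_div_succ s c0
    rw [← hg] at b1
    nlinarith
  have a3 : g * c ≤ s := hg ▸ Nat.div_mul_le_self _ _
  have a4 : P * c ≤ 2 * B := by
    have := Nat.mul_div_le (B + P - 1) P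
    rw [← hc] at this
    omega
  calc R * s ≤ R * (2 * (g * c)) := Nat.mul_le_mul_left _ a2
    _ = 2 * c * (R * g) := by ring
    _ ≤ 2 * c * (n * P + g) := Nat.mul_le_mul_left _ a1
    _ = 2 * (n * (P * c)) + 2 * (g * c) := by ring
    _ ≤ 2 * (n * (2 * B)) + 2 * s := by gcongr
    _ = 4 * (n * B) + 2 * s := by ring

theorem geomSum_mul_le {s : ℕ} (hs : 2 ≤ s) (e : ℕ) :
    (∑ i ∈ Finset.range e, s ^ i) * s ≤ 2 * s ^ e := by
  induction e with
  | zero => simp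
  | succ e ih =>
    rw [Finset.sum_range_succ, Nat.add_mul, pow_succ]
    nlinarith [Nat.mul_le_mul_left (s ^ e) hs]

/-- An additive function with nonnegative values is monotone and satisfies f(kq) = k·f(q). -/
theorem mmWork_le_mul (f : ℕ →+ ℝ≥0) {a k q : ℕ} (h : a ≤ k * q) : f a ≤ k * f q := by
  obtain ⟨d, hd⟩ := Nat.exists_eq_add_of_le h
  have h1 : f (k * q) = k * f q := by rw [← smul_eq_mul, map_nsmul, nsmul_eq_mul]
  rw [← h1, hd, map_add]
  exact le_self_add

theorem work_le {s B e n P g R q : ℕ} (hs : 2 ≤ s) (hn : 1 ≤ n) (hP : P = s ^ e) (h₁ : P ≤ B)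
    (h₂ : B < s ^ (e + 1)) (hB : 0 < B) (hg : g = s / ((B + P - 1) / P))
    (hR : R = (n * P + g - 1) / g) (hq : n * B ≤ q * s) (f : ℕ →+ ℝ≥0) :
    f R + f (n * ∑ i ∈ Finset.range e, s ^ i) +
        ((2 * (n * B) + 2 * (R * s * B) + 2 * (n * P * B) +
          2 * B * (n * ∑ i ∈ Finset.range e, s ^ i) + 2 * (n * B) + 11 * e + 20 : ℕ) : ℝ≥0) ≤
      200 * (f q + n * s * B ^ 2) := by
  have hs0 : 0 < s := by omega
  have hRs := mul_rows_le hs0 hP h₁ h₂ hB rfl hg hR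
  have hG := geomSum_mul_le hs e
  rw [← hP] at hG
  set G := ∑ i ∈ Finset.range e, s ^ i
  have hq0 : 1 ≤ q := by
    rcases Nat.eq_zero_or_pos q with h | h
    · have : 0 < n * B := by positivity
      rw [h] at hq; omega
    · exact h
  -- R·s ≤ 4nB + 2s ≤ 6qs, by nB ≤ qs and q ≥ 1. Similarly nG·s ≤ 2nP ≤ 2qs gives the factor 2
  -- below.
  have f1 : f R ≤ (6 : ℕ) * f q := mmWork_le_mul f (by
    refine Nat.le_of_mul_le_mul_right ?_ hs0
    have := Nat.mul_le_mul_right s hq0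
    nlinarith)
  have f2 : f (n * G) ≤ (2 : ℕ) * f q := mmWork_le_mul f (by
    refine Nat.le_of_mul_le_mul_right ?_ hs0
    have h1 : n * G * s ≤ n * (2 * B) := by
      rw [Nat.mul_assoc]
      exact Nat.mul_le_mul_left _ (hG.trans (Nat.mul_le_mul_left _ h₁))
    nlinarith)
  have hGB : G ≤ B := by
    have := Nat.mul_le_mul_left G hs
    omega
  have heB : e ≤ B := by
    have h1 : e < 2 ^ e := Nat.lt_two_pow_self
    have h2 : 2 ^ e ≤ s ^ e := Nat.pow_le_pow_left hs e
    omega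
  have hnat : 2 * (n * B) + 2 * (R * s * B) + 2 * (n * P * B) + 2 * B * (n * G) + 2 * (n * B) +
      11 * e + 20 ≤ 200 * (n * s * B ^ 2) := by
    set T := n * s * B ^ 2 with hT
    have g0 : n * B * B ≤ T := by
      rw [hT, pow_two, Nat.mul_assoc n B B]
      exact Nat.mul_le_mul_right _ (Nat.le_mul_of_pos_right _ hs0)
    have g1 : n * B ≤ n * B * B := Nat.le_mul_of_pos_right _ hB
    have g2 : s * B ≤ T := by
      rw [hT, pow_two]
      exact Nat.mul_le_mul (Nat.le_mul_of_pos_left _ hn) (Nat.le_mul_of_pos_left _ hB)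
    have g3 : n * P * B ≤ n * B * B := Nat.mul_le_mul_right _ (Nat.mul_le_mul_left _ h₁)
    have g4 : B * (n * G) ≤ n * B * B := by
      rw [Nat.mul_comm]
      exact Nat.mul_le_mul_right _ (Nat.mul_le_mul_left _ hGB)
    have g5 : R * s * B ≤ 4 * (n * B * B) + 2 * (s * B) := by
      calc R * s * B ≤ (4 * (n * B) + 2 * s) * B := Nat.mul_le_mul_right _ hRs
        _ = _ := by ring
    have g6 : B ≤ n * B := Nat.le_mul_of_pos_left _ hn
    have g7 : 2 * B * (n * G) = 2 * (B * (n * G)) := by ring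
    omega
  calc f R + f (n * G) + _ ≤ (6 : ℕ) * f q + (2 : ℕ) * f q + ((200 * (n * s * B ^ 2) : ℕ) : ℝ≥0) :=
        add_le_add (add_le_add f1 f2) (Nat.cast_le.2 hnat)
    _ = 8 * f q + 200 * (n * s * B ^ 2) := by push_cast; ring
    _ ≤ 200 * f q + 200 * (n * s * B ^ 2) := by gcongr; norm_num
    _ = _ := by ring

end MMVRAM

/-! ### Choice of the constants -/

theorem mainTheorem7 :
    ∃ (MULT : MMVRAM.Prog) (C : ℕ),
      ∀ (s n M B : ℕ), 2 ≤ s → 1 ≤ n → 1 ≤ M →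
        (C : ℝ) * (1 + Real.logb 2 n + Real.logb 2 M) ≤ B →
        ∀ (mmWork : ℕ →+ NNReal) (x y : Fin n → ℤ),
          (∀ i, |x i| ≤ (M : ℤ)) → (∀ i, |y i| ≤ (M : ℤ)) →
          ∃ (τ : MMVRAM.State B) (steps : ℕ) (work : NNReal),
            MMVRAM.Exec ⟨s, B, (n * s * B) ^ C, mmWork⟩ MULT
              (MMVRAM.initState ⟨s, B, (n * s * B) ^ C, mmWork⟩ x y) τ steps work ∧
            MMVRAM.IsOutput τ (fun i => x i * y i) ∧
            (steps : ℝ) ≤ C * (1 + Real.logb s B) ∧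
            (work : ℝ) ≤ C * ((mmWork ⌈((n : ℚ) * B) / s⌉₊ : ℝ) + n * s * B ^ 2) := by
  refine ⟨MMVRAM.multProg, 200, fun s n M B hs hn hM hB mmWork x y hx hy => ?_⟩
  have hs0 : 0 < s := by omega
  have hlogn : 0 ≤ Real.logb 2 n := Real.logb_nonneg (by norm_num) (by exact_mod_cast hn)
  have hlogM : 0 ≤ Real.logb 2 M := Real.logb_nonneg (by norm_num) (by exact_mod_cast hM)
  push_cast at hB
  have hB200 : 200 ≤ B := by
    have : (200 : ℝ) ≤ B := by linarith
    exact_mod_cast this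
  -- As ⌊B/4⌋ > B/4 - 1 ≥ 50(1 + log₂ M) - 1, the inputs have fewer than ⌊B/4⌋ bits with ample room.
  have hM2 : (M : ℤ) < 2 ^ (B / 4) := by
    have h1 : (B : ℝ) < 4 * ((B / 4 : ℕ) : ℝ) + 4 := by
      have : B < 4 * (B / 4) + 4 := by omega
      exact_mod_cast this
    have h2 : (200 : ℝ) ≤ B := by exact_mod_cast hB200
    have h3 : Real.logb 2 M < ((B / 4 : ℕ) : ℝ) := by linarith
    rw [Real.logb_lt_iff_lt_rpow (by norm_num) (by exact_mod_cast hM), Real.rpow_natCast] at h3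
    exact_mod_cast h3
  -- For s > B this gives e = 0: the first round alone adds up all partial products.
  obtain ⟨e, h₁, h₂⟩ : ∃ e, s ^ e ≤ B ∧ B < s ^ (e + 1) :=
    ⟨Nat.log s B, Nat.pow_log_le_self s (by omega), Nat.lt_pow_succ_log_self (by omega) B⟩
  have hN : 0 < n * s * B := by positivity
  obtain ⟨τ, w, hex, hout, hw⟩ := MMVRAM.exec_mult (m := ⟨s, B, (n * s * B) ^ 200, mmWork⟩)
    (n := n) (e := e) hs hn (by change 6 ≤ B; omega) h₁ h₂
    (Nat.pow_le_pow_right hN (by norm_num)) x y (fun i => (hx i).trans_lt hM2)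
    (fun i => (hy i).trans_lt hM2) rfl rfl rfl
  refine ⟨τ, _, w, hex, hout, ?_, ?_⟩
  · have he : (e : ℝ) ≤ Real.logb s B := by
      rw [Real.le_logb_iff_rpow_le (by exact_mod_cast hs) (by positivity), Real.rpow_natCast]
      exact_mod_cast h₁
    push_cast
    have : (0 : ℝ) ≤ e := Nat.cast_nonneg e
    linarith
  · have hq : n * B ≤ ⌈((n : ℚ) * B) / s⌉₊ * s := by
      have h1 := Nat.le_ceil (((n : ℚ) * B) / s)
      rw [div_le_iff₀ (by exact_mod_cast hs0)] at h1
      exact_mod_cast h1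
    have := hw.trans (MMVRAM.work_le hs hn rfl h₁ h₂ (by omega) rfl rfl hq mmWork)
    exact_mod_cast this
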